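/- Let $N\ge 2$ and consider $N$ identical agents $$\dot x_i=Ax_i+Bu_i+Ed_i,\qquad y_i=C_1x_i+D_1d_i,\qquad z_i=C_2x_i+D_2u_i,\qquad i=1,\dots,N,$$ with real matrices of compatible dimensions, state $x_i\in\mathbb R^n$, input $u_i\in\mathbb R^m$, disturbance $d_i\in\mathbb R^q$, outputs $y_i\in\mathbb R^r$, $z_i\in\mathbb R^p$, where $(A,B)$ is stabilizable and $(C_1,A)$ is detectable. The communication graph is a connected simple undirected weighted graph with adjacency matrix $[a_{ij}]$ ($a_{ij}=a_{ji}\ge 0$, $a_{ii}=0$, and $i,j$ adjacent iff $a_{ij}>0$), Laplacian $L$ with eigenvalues $0=\lambda_1<\lambda_2\le\dots\le\lambda_N$, an incidence matrix $R\in\mathbb R^{N\times K}$ ($K$ the number of undirected edges, each with an arbitrary orientation), and diagonal matrix $W$ of edge weights, so that $L=RWR^\top$. For gains $F\in\mathbb R^{m\times n}$, $G\in\mathbb R^{n\times r}$ consider the protocol $$\dot w_i=Aw_i+B\sum_{j}a_{ij}(u_i-u_j)+G\Big(\sum_{j}a_{ij}(y_i-y_j)-C_1w_i\Big),\qquad u_i=Fw_i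 .$$ It synchronizes the network if, for $d_i\equiv 0$ and all initial states, $x_i(t)-x_j(t)\to0$ and $w_i(t)-w_j(t)\to0$ as $t\to\infty$ for all $i,j$. With $$A_e=\begin{pmatrix} I_N\otimes A& I_N\otimes BF\\ L\otimes GC_1& I_N\otimes(A-GC_1)+L\otimes BF\end{pmatrix},\quad E_e=\begin{pmatrix}I_N\otimes E\\ L\otimes GD_1\end{pmatrix},\quad C_e=\begin{pmatrix}W^{1/2}R^\top\otimes C_2& W^{1/2}R^\top\otimes D_2F\end{pmatrix},$$ let $T_{F,G}(t)=C_ee^{A_et}E_e$ and $J(F,G)=\int_0^\infty \mathrm{tr}\big[T_{F,G}(t)^\top T_{F,G}(t)\big]\,dt$. For a symmetric matrix $M$, $M>0$ ($M<0$) means that $M$ is positive (negative) definite. Theorem. Let $\gamma>0$. Assume $D_1E^\top=0$, $D_2^\top C_2=0$, $D_1D_1^\top=I_r$ and $D_2^\top D_2=I_m$. Let $Q>0$ satisfy $$AQ+QA^\top-QC_1^\top C_1Q+EE^\top<0,$$ and let $0<c<2/\lambda_N^2$. (i) If $\dfrac{2}{\lambda_2^2+\lambda_2\lambda_N+\lambda_N^2}\le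 c<\dfrac{2}{\lambda_N^2}$, then there exists $P>0$ satisfying $$A^\top P+PA+(c^2\lambda_N^3-2c\lambda_N)PBB^\top P+\lambda_NC_2^\top C_2<0.$$ (ii) If $0<c<\dfrac{2}{\lambda_2^2+\lambda_2\lambda_N+\lambda_N^2}$, then there exists $P>0$ satisfying $$A^\top P+PA+(c^2\lambda_2^3-2c\lambda_2)PBB^\top P+\lambda_NC_2^\top C_2<0.$$ In both cases, if $P>0$ is any solution of the respective inequality such that in addition $$\mathrm{tr}(C_1QPQC_1^\top)+\lambda_N\,\mathrm{tr}(C_2QC_2^\top)<\frac{\gamma}{N-1},$$ then the protocol with $F=-cB^\top P$ and $G=QC_1^\top$ synchronizes the network, and the integral defining $J(F,G)$ converges with $J(F,G)<\gamma$. -/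

import Mathlib

open Matrix Set Filter Topology MeasureTheory
open scoped Kronecker

namespace DistH2

/-- All (complex) eigenvalues have negative real part. -/
def IsHurwitz {n : ℕ} (M : Matrix (Fin n) (Fin n) ℝ) : Prop :=
  ∀ μ ∈ spectrum ℂ (M.map (Complex.ofReal)), μ.re < 0

/-- `M < 0`: the matrix `M` is symmetric and negative definite. -/
def NegDef {n : ℕ} (M : Matrix (Fin n) (Fin n) ℝ) : Prop :=
  (-M).PosDef

/-- The matrices of the agent dynamics
`x' = A x + B u + E d`, `y = C₁ x + D₁ d`, `z = C₂ x + D₂ u`. -/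
structure Agent (n m q r p : ℕ) where
  A : Matrix (Fin n) (Fin n) ℝ
  B : Matrix (Fin n) (Fin m) ℝ
  E : Matrix (Fin n) (Fin q) ℝ
  C₁ : Matrix (Fin r) (Fin n) ℝ
  D₁ : Matrix (Fin r) (Fin q) ℝ
  C₂ : Matrix (Fin p) (Fin n) ℝ
  D₂ : Matrix (Fin p) (Fin m) ℝ

/-- The pair `(A, B)` is stabilizable. -/
def Stabilizable {n m : ℕ} (A : Matrix (Fin n) (Fin n) ℝ) (B : Matrix (Fin n) (Fin m) ℝ) : Prop :=
  ∃ K : Matrix (Fin m) (Fin n) ℝ, IsHurwitz (A + B * K)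

/-- The pair `(C, A)` is detectable. -/
def Detectable {n r : ℕ} (C : Matrix (Fin r) (Fin n) ℝ) (A : Matrix (Fin n) (Fin n) ℝ) : Prop :=
  ∃ K : Matrix (Fin n) (Fin r) ℝ, IsHurwitz (A + K * C)

/-- A simple undirected weighted graph on `N` nodes, given by its adjacency matrix;
`i` and `j` are joined by an edge exactly when `a i j > 0`. -/
structure WeightedGraph (N : ℕ) where
  a : Matrix (Fin N) (Fin N) ℝ
  nonneg : ∀ i j, 0 ≤ a i j
  symm : ∀ i j, a i j = a j i
  loopless : ∀ i, a i i = 0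

namespace WeightedGraph

variable {N : ℕ} (g : WeightedGraph N)

/-- The underlying unweighted graph. -/
def toSimpleGraph : SimpleGraph (Fin N) where
  Adj i j := 0 < g.a i j
  symm := ⟨fun i j h => by rw [g.symm j i]; exact h⟩
  loopless := ⟨fun i h => by rw [g.loopless i] at h; exact lt_irrefl _ h⟩

/-- The graph is connected. -/
def IsConnected : Prop := g.toSimpleGraph.Connected

/-- The Laplacian matrix: degree matrix minus adjacency matrix. -/
def laplacian : Matrix (Fin N) (Fin N) ℝ :=
  Matrix.diagonal (fun i => ∑ j, g.a i j) - g.a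

theorem laplacian_isHermitian : g.laplacian.IsHermitian := by
  unfold laplacian
  refine (Matrix.isHermitian_diagonal _).sub ?_
  ext i j
  simp [g.symm i j]

/-- The eigenvalues of the Laplacian with multiplicity, in increasing order (index `k : Fin N`
stands for the `(k+1)`-st smallest one; Mathlib's `eigenvalues₀` is decreasing). -/
noncomputable def eigenvalue (k : Fin N) : ℝ :=
  g.laplacian_isHermitian.eigenvalues₀ (Fin.cast (Fintype.card_fin N).symm k.rev)

/-- `λ₂`, the second smallest Laplacian eigenvalue. -/
noncomputable def lambdaTwo (hN : 2 ≤ N) : ℝ := g.eigenvalue ⟨1, by omega⟩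

/-- `λ_N`, the largest Laplacian eigenvalue. -/
noncomputable def lambdaMax (hN : 2 ≤ N) : ℝ := g.eigenvalue ⟨N - 1, by omega⟩

/-- An enumeration of the `K` undirected edges of the graph, each given an arbitrary direction. -/
structure EdgeOrientation (K : ℕ) where
  src : Fin K → Fin N
  tgt : Fin K → Fin N
  isEdge : ∀ k, 0 < g.a (src k) (tgt k)
  existsUnique : ∀ i j, 0 < g.a i j →
    ∃! k, (src k = i ∧ tgt k = j) ∨ (src k = j ∧ tgt k = i)

namespace EdgeOrientation

variable {g} {K : ℕ} (o : g.EdgeOrientation K)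

/-- The incidence matrix `R` of the oriented graph. -/
def incidence : Matrix (Fin N) (Fin K) ℝ :=
  Matrix.of fun v k => if v = o.src k then 1 else if v = o.tgt k then -1 else 0

/-- `W^{1/2}`, where `W` is the diagonal matrix of edge weights. -/
noncomputable def sqrtWeight : Matrix (Fin K) (Fin K) ℝ :=
  Matrix.diagonal fun k => Real.sqrt (g.a (o.src k) (o.tgt k))

end EdgeOrientation

end WeightedGraph

section Network

variable {n m q r p N K : ℕ} (S : Agent n m q r p) (g : WeightedGraph N)
  (F : Matrix (Fin m) (Fin n) ℝ) (G : Matrix (Fin n) (Fin r) ℝ)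

/-- `x`, `w` are state trajectories on `[0, ∞)` of the network of agents interconnected by
the protocol
`w_i' = A w_i + B ∑ⱼ aᵢⱼ (u_i - u_j) + G (∑ⱼ aᵢⱼ (y_i - y_j) - C₁ w_i)`, `u_i = F w_i`,
under the disturbances `d`. -/
structure IsTrajectory (d : Fin N → ℝ → Fin q → ℝ) (x w : Fin N → ℝ → Fin n → ℝ)
    (u : Fin N → ℝ → Fin m → ℝ) (y : Fin N → ℝ → Fin r → ℝ) : Prop where
  input : ∀ i t, u i t = F *ᵥ w i t
  output : ∀ i t, y i t = S.C₁ *ᵥ x i t + S.D₁ *ᵥ d i t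
  state : ∀ i, ∀ t ∈ Ici (0 : ℝ),
    HasDerivWithinAt (x i) (S.A *ᵥ x i t + S.B *ᵥ u i t + S.E *ᵥ d i t) (Ici 0) t
  observer : ∀ i, ∀ t ∈ Ici (0 : ℝ),
    HasDerivWithinAt (w i)
      (S.A *ᵥ w i t + S.B *ᵥ (∑ j, g.a i j • (u i t - u j t))
        + G *ᵥ ((∑ j, g.a i j • (y i t - y j t)) - S.C₁ *ᵥ w i t)) (Ici 0) t

/-- The protocol with gains `F`, `G` synchronizes the network: with zero disturbances, the
differences of the agent states and of the protocol states all tend to zero. -/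
def Synchronizes : Prop :=
  ∀ x w u y, IsTrajectory S g F G (fun _ _ => 0) x w u y →
    ∀ i j, Tendsto (fun t => x i t - x j t) atTop (𝓝 0) ∧
      Tendsto (fun t => w i t - w j t) atTop (𝓝 0)

/-- System matrix of the controlled network. -/
def Ae : Matrix (Fin N × Fin n ⊕ Fin N × Fin n) (Fin N × Fin n ⊕ Fin N × Fin n) ℝ :=
  Matrix.fromBlocks
    ((1 : Matrix (Fin N) (Fin N) ℝ) ⊗ₖ S.A)
    ((1 : Matrix (Fin N) (Fin N) ℝ) ⊗ₖ (S.B * F))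
    (g.laplacian ⊗ₖ (G * S.C₁))
    ((1 : Matrix (Fin N) (Fin N) ℝ) ⊗ₖ (S.A - G * S.C₁) + g.laplacian ⊗ₖ (S.B * F))

/-- Disturbance input matrix of the controlled network. -/
def Ee : Matrix (Fin N × Fin n ⊕ Fin N × Fin n) (Fin N × Fin q) ℝ :=
  Matrix.fromRows
    ((1 : Matrix (Fin N) (Fin N) ℝ) ⊗ₖ S.E)
    (g.laplacian ⊗ₖ (G * S.D₁))

variable {g} in
/-- Output matrix of the controlled network, for the output `ζ = (W^{1/2} Rᵀ ⊗ I) z`. -/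
noncomputable def Ce (o : g.EdgeOrientation K) :
    Matrix (Fin K × Fin p) (Fin N × Fin n ⊕ Fin N × Fin n) ℝ :=
  Matrix.fromCols
    ((o.sqrtWeight * o.incidenceᵀ) ⊗ₖ S.C₂)
    ((o.sqrtWeight * o.incidenceᵀ) ⊗ₖ (S.D₂ * F))

variable {g} in
/-- The impulse response matrix `T_{F,G}(t) = C_e e^{A_e t} E_e`. -/
noncomputable def impulseResponse (o : g.EdgeOrientation K) (t : ℝ) :
    Matrix (Fin K × Fin p) (Fin N × Fin q) ℝ :=
  Ce S F o * NormedSpace.exp (t • Ae S g F G) * Ee S g G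

variable {g} in
/-- The integrand `tr (T(t)ᵀ T(t))` of the cost. -/
noncomputable def costDensity (o : g.EdgeOrientation K) (t : ℝ) : ℝ :=
  ((impulseResponse S F G o t)ᵀ * impulseResponse S F G o t).trace

variable {g} in
/-- The `H₂` cost `J(F, G) = ∫₀^∞ tr (T(t)ᵀ T(t)) dt` (meaningful when the integrand is
integrable). -/
noncomputable def cost (o : g.EdgeOrientation K) : ℝ :=
  ∫ t in Ioi (0 : ℝ), costDensity S F G o t

variable {g} in
/-- The protocol with gains `F`, `G` synchronizes the network and its cost is finite and
smaller than `γ`. -/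
def SolvesProblem (o : g.EdgeOrientation K) (γ : ℝ) : Prop :=
  Synchronizes S g F G ∧
    IntegrableOn (costDensity S F G o) (Ioi (0 : ℝ)) ∧ cost S F G o < γ

end Network

end DistH2

/-! Orthonormal eigenvectors of the Laplacian split the network into N independent modes of state
dimension 2n, one for each eigenvalue λ. Since L = R W Rᵀ, the cost is the sum over the modes of λ
times the squared H₂ norm of the mode (`costDensity_eq_sum`). The mode λ = 0 thus costs nothing, and
by connectedness its eigenvector is constant, so it does not affect differences between agents
either. It remains to make each of the N - 1 other modes stable with weighted cost below γ/(N - 1).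

In a mode with λ > 0, w/λ is an estimate x̂ of x, with error e = x - x̂. For G = QC₁ᵀ, an ansatz
with uncorrelated e and x̂ (`modeCov`) separates the Lyapunov inequality (`modeA_lyapunov`): the
block of e is the filter Riccati inequality for Q, and the block of x̂ is an inequality for its
covariance Y with system matrix A + λBF and noise GGᵀ. The output trace splits in the same way
(`trace_modeC`).

The cost due to Y is bounded by duality with P. If P satisfies the Riccati inequality with
coefficient c²λ³ - 2cλ and weight λC₂ᵀC₂, then λ tr((C₂ᵀC₂ + λ²FᵀF)Y) exceeds tr(PGGᵀ) =
tr(C₁QPQC₁ᵀ) by at most an arbitrarily small amount (`exists_modeCov`). One P serves all modes if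
its coefficient dominates c²λ³ - 2cλ on [λ₂, λ_N]. This function is convex for λ > 0, so its maximum
lies at an endpoint, and the threshold on c decides which one. There the coefficient is negative
because c < 2/λ_N², and stabilizability then yields P (`Stabilizable.exists_riccati`). -/

namespace DistH2

/-! ### Derivatives of vector-valued curves and the matrix exponential -/

section Calculus

variable {ι κ : Type*} [Fintype ι]

theorem hasDerivWithinAt_dotProduct {u v : ℝ → ι → ℝ} {u' v' : ι → ℝ} {s : Set ℝ} {t : ℝ}
    (hu : HasDerivWithinAt u u' s t) (hv : HasDerivWithinAt v v' s t) :
    HasDerivWithinAt (fun t => u t ⬝ᵥ v t) (u' ⬝ᵥ v t + u t ⬝ᵥ v') s t := by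
  have h := HasDerivWithinAt.fun_sum (u := Finset.univ) fun i _ =>
    (hasDerivWithinAt_pi.1 hu i).fun_mul (hasDerivWithinAt_pi.1 hv i)
  simpa [dotProduct, Finset.sum_add_distrib] using h

theorem hasDerivWithinAt_mulVec [Fintype κ] (M : Matrix κ ι ℝ) {u : ℝ → ι → ℝ} {u' : ι → ℝ} {s : Set ℝ}
    {t : ℝ} (hu : HasDerivWithinAt u u' s t) :
    HasDerivWithinAt (fun t => M *ᵥ u t) (M *ᵥ u') s t := by
  refine hasDerivWithinAt_pi.2 fun i => ?_
  have h := HasDerivWithinAt.fun_sum (u := Finset.univ) fun j _ =>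
    (hasDerivWithinAt_pi.1 hu j).const_mul (M i j)
  simpa [mulVec, dotProduct] using h

variable [Fintype κ] [DecidableEq ι] [DecidableEq κ]

attribute [local instance] Matrix.linftyOpNormedRing Matrix.linftyOpNormedAlgebra

theorem hasDerivAt_exp_smul_mulVec (A : Matrix ι ι ℝ) (v : ι → ℝ) (t : ℝ) :
    HasDerivAt (fun t : ℝ => NormedSpace.exp (t • A) *ᵥ v)
      (A *ᵥ (NormedSpace.exp (t • A) *ᵥ v)) t := by
  have h := hasDerivAt_exp_smul_const' (𝕂 := ℝ) A t
  let T : Matrix ι ι ℝ →ₗ[ℝ] (ι → ℝ) := (Matrix.mulVecBilin ℝ ℝ).flip v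
  have h2 := (LinearMap.toContinuousLinearMap T).hasFDerivAt.comp_hasDerivAt t h
  rw [mulVec_mulVec]
  exact h2

/-- The relation passes to all powers, hence to the exponential series. X may be rectangular: it
will be an eigenvector column or the projection of the network onto a mode. -/
theorem mul_exp_of_semiconj {𝕜 : Type*} [RCLike 𝕜] {X : Matrix κ ι 𝕜} {A : Matrix ι ι 𝕜}
    {B : Matrix κ κ 𝕜} (h : X * A = B * X) :
    X * NormedSpace.exp A = NormedSpace.exp B * X := by
  let _ : NormedRing (Matrix ι ι 𝕜) := Matrix.linftyOpNormedRing
  let _ : NormedAlgebra 𝕜 (Matrix ι ι 𝕜) := Matrix.linftyOpNormedAlgebra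
  let _ : NormedRing (Matrix κ κ 𝕜) := Matrix.linftyOpNormedRing
  let _ : NormedAlgebra 𝕜 (Matrix κ κ 𝕜) := Matrix.linftyOpNormedAlgebra
  have hpow : ∀ k : ℕ, X * A ^ k = B ^ k * X := by
    intro k
    induction k with
    | zero => simp
    | succ k ih => rw [pow_succ, ← Matrix.mul_assoc, ih, Matrix.mul_assoc, h, ← Matrix.mul_assoc,
        ← pow_succ]
  have hA := (NormedSpace.exp_series_hasSum_exp' (𝕂 := 𝕜) A).map
    (AddMonoidHom.mk' (fun M : Matrix ι ι 𝕜 => X * M) (Matrix.mul_add X))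
    (show Continuous fun M : Matrix ι ι 𝕜 => X * M from continuous_const.matrix_mul continuous_id)
  have hB := (NormedSpace.exp_series_hasSum_exp' (𝕂 := 𝕜) B).map
    (AddMonoidHom.mk' (fun M : Matrix κ κ 𝕜 => M * X) (fun a b => Matrix.add_mul a b X))
    (show Continuous fun M : Matrix κ κ 𝕜 => M * X from continuous_id.matrix_mul continuous_const)
  refine hA.unique ?_
  convert hB using 1
  · funext k
    simp [hpow]
  · rfl

end Calculus

/-! ### Real quadratic forms -/

section QuadraticForms

variable {ι κ : Type*} [Fintype ι] [Fintype κ]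

theorem posDef_real_iff {M : Matrix ι ι ℝ} :
    M.PosDef ↔ Mᵀ = M ∧ ∀ x : ι → ℝ, x ≠ 0 → 0 < x ⬝ᵥ M *ᵥ x := by
  rw [posDef_iff_dotProduct_mulVec]
  simp [Matrix.IsHermitian, conjTranspose_eq_transpose_of_trivial]

theorem posSemidef_real_iff {M : Matrix ι ι ℝ} :
    M.PosSemidef ↔ Mᵀ = M ∧ ∀ x : ι → ℝ, 0 ≤ x ⬝ᵥ M *ᵥ x := by
  rw [posSemidef_iff_dotProduct_mulVec]
  simp [Matrix.IsHermitian, conjTranspose_eq_transpose_of_trivial]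

/-- A positive definite form dominates a small multiple of any other form. -/
theorem exists_pos_mul_abs_lt {M : Matrix ι ι ℝ} (hM : M.PosDef) (R : Matrix ι ι ℝ) :
    ∃ ε > 0, ∀ x : ι → ℝ, x ≠ 0 → ε * |x ⬝ᵥ R *ᵥ x| < x ⬝ᵥ M *ᵥ x := by
  have hcont : ∀ S : Matrix ι ι ℝ, Continuous fun x : ι → ℝ => x ⬝ᵥ S *ᵥ x := fun S => by
    simp only [dotProduct, mulVec]; fun_prop
  rcases isEmpty_or_nonempty ι with hι | hι
  · exact ⟨1, one_pos, fun x hx => (hx (Subsingleton.elim _ _)).elim⟩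
  have hne : (Metric.sphere (0 : ι → ℝ) 1).Nonempty := NormedSpace.sphere_nonempty.2 zero_le_one
  have hK := isCompact_sphere (0 : ι → ℝ) 1
  obtain ⟨a, ha, hamin⟩ := hK.exists_isMinOn hne (hcont M).continuousOn
  obtain ⟨b, hb, hbmax⟩ := hK.exists_isMaxOn hne (hcont R).abs.continuousOn
  have ha0 : a ≠ 0 := by rintro rfl; simp at ha
  have hma := (posDef_real_iff.1 hM).2 a ha0
  -- Minimum of M over maximum of |R| on the unit sphere; the added 1 makes the denominator positive
  -- and the inequality strict.
  refine ⟨(a ⬝ᵥ M *ᵥ a) / (|b ⬝ᵥ R *ᵥ b| + 1), by positivity, fun x hx => ?_⟩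
  have hx0 : 0 < ‖x‖ := norm_pos_iff.2 hx
  set y : ι → ℝ := ‖x‖⁻¹ • x with hy
  have hys : y ∈ Metric.sphere (0 : ι → ℝ) 1 := by
    simp [hy, norm_smul, hx0.ne']
  have hxy : x = ‖x‖ • y := by simp [hy, smul_smul, hx0.ne']
  have hq : ∀ S : Matrix ι ι ℝ, x ⬝ᵥ S *ᵥ x = ‖x‖ ^ 2 * (y ⬝ᵥ S *ᵥ y) := fun S => by
    conv_lhs => rw [hxy]
    simp only [smul_dotProduct, dotProduct_smul, mulVec_smul, smul_eq_mul]; ring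
  rw [hq R, hq M, abs_mul, abs_of_nonneg (sq_nonneg ‖x‖), mul_left_comm]
  refine mul_lt_mul_of_pos_left ?_ (by positivity)
  have h1 : a ⬝ᵥ M *ᵥ a ≤ y ⬝ᵥ M *ᵥ y := hamin hys
  have h2 : |y ⬝ᵥ R *ᵥ y| ≤ |b ⬝ᵥ R *ᵥ b| := hbmax hys
  refine lt_of_lt_of_le ?_ h1
  rw [div_mul_eq_mul_div, div_lt_iff₀ (by positivity)]
  nlinarith

theorem dotProduct_mulVec_comm_of_symm {M : Matrix ι ι ℝ} (hM : Mᵀ = M) (x y : ι → ℝ) :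
    x ⬝ᵥ M *ᵥ y = y ⬝ᵥ M *ᵥ x := by
  rw [dotProduct_mulVec, ← mulVec_transpose, hM, dotProduct_comm]

theorem mulVec_dotProduct (M : Matrix κ ι ℝ) (x : ι → ℝ) (y : κ → ℝ) :
    (M *ᵥ x) ⬝ᵥ y = x ⬝ᵥ Mᵀ *ᵥ y := by
  rw [dotProduct_mulVec, vecMul_transpose]

theorem posDef_congr_inv [DecidableEq ι] {X M : Matrix ι ι ℝ} (hX : X.PosDef) (hM : M.PosDef) :
    (X⁻¹ * M * X⁻¹).PosDef := by
  have hXi := hX.inv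
  have h := hM.conjTranspose_mul_mul_same (B := X⁻¹)
    (Matrix.mulVec_injective_iff_isUnit.2 hXi.isUnit)
  rwa [hXi.isHermitian.eq] at h

end QuadraticForms

/-! ### Lyapunov stability and the Lyapunov equation -/

section Lyapunov

variable {ι : Type*} [Fintype ι]

theorem hasDerivWithinAt_quadratic (A P : Matrix ι ι ℝ) {u v : ℝ → ι → ℝ} {s : Set ℝ} {t : ℝ}
    (hu : HasDerivWithinAt u (A *ᵥ u t) s t) (hv : HasDerivWithinAt v (A *ᵥ v t) s t) :
    HasDerivWithinAt (fun t => u t ⬝ᵥ P *ᵥ v t) (u t ⬝ᵥ (Aᵀ * P + P * A) *ᵥ v t) s t := by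
  convert hasDerivWithinAt_dotProduct hu (hasDerivWithinAt_mulVec P hv) using 1
  rw [mulVec_dotProduct, add_mulVec, dotProduct_add, mulVec_mulVec, mulVec_mulVec]

/-- Lyapunov's theorem: a quadratic Lyapunov function forces all trajectories to zero. -/
theorem tendsto_zero_of_lyapunov {A P : Matrix ι ι ℝ} (hP : P.PosDef)
    (hL : (-(Aᵀ * P + P * A)).PosDef) {x : ℝ → ι → ℝ}
    (hx : ∀ t ∈ Ici (0 : ℝ), HasDerivWithinAt x (A *ᵥ x t) (Ici 0) t) :
    Tendsto x atTop (𝓝 0) := by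
  classical
  -- With V = xᵀPx this choice gives V' ≤ -εV, so exp(εt)V is nonincreasing; δ then turns the decay
  -- of V into decay of x.
  obtain ⟨ε, hε, hεP⟩ := exists_pos_mul_abs_lt hL P
  obtain ⟨δ, hδ, hδP⟩ := exists_pos_mul_abs_lt hP (1 : Matrix ι ι ℝ)
  have hV : ∀ t ∈ Ici (0 : ℝ), HasDerivWithinAt
      (fun t => Real.exp (ε * t) * (x t ⬝ᵥ P *ᵥ x t))
      (Real.exp (ε * t) * (ε * (x t ⬝ᵥ P *ᵥ x t) + x t ⬝ᵥ (Aᵀ * P + P * A) *ᵥ x t))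
      (Ici 0) t := fun t ht => by
    have h1 : HasDerivAt (fun t : ℝ => Real.exp (ε * t)) (Real.exp (ε * t) * (ε * 1)) t :=
      ((hasDerivAt_id t).const_mul ε).exp
    exact (h1.hasDerivWithinAt.fun_mul
      (hasDerivWithinAt_quadratic A P (hx t ht) (hx t ht))).congr_deriv (by ring)
  have hanti : AntitoneOn (fun t => Real.exp (ε * t) * (x t ⬝ᵥ P *ᵥ x t)) (Ici 0) := by
    refine antitoneOn_of_hasDerivWithinAt_nonpos (convex_Ici 0)
      (fun t ht => (hV t ht).continuousWithinAt)
      (fun t ht => (hV t (interior_subset ht)).mono interior_subset) fun t _ => ?_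
    refine mul_nonpos_of_nonneg_of_nonpos (Real.exp_pos _).le ?_
    by_cases h0 : x t = 0
    · simp [h0]
    · have h1 := hεP _ h0
      rw [neg_mulVec, dotProduct_neg] at h1
      nlinarith [le_abs_self (x t ⬝ᵥ P *ᵥ x t)]
  have hbound : ∀ t ∈ Ici (0 : ℝ), ∀ i,
      x t i ^ 2 ≤ δ⁻¹ * (Real.exp (-(ε * t)) * (x 0 ⬝ᵥ P *ᵥ x 0)) := fun t ht i => by
    have h1 := hanti (mem_Ici.2 le_rfl) ht ht
    simp only [mul_zero, Real.exp_zero, one_mul] at h1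
    have h2 : x t ⬝ᵥ P *ᵥ x t ≤ Real.exp (-(ε * t)) * (x 0 ⬝ᵥ P *ᵥ x 0) := by
      rw [Real.exp_neg, inv_mul_eq_div, le_div_iff₀ (Real.exp_pos _), mul_comm]; exact h1
    have h3 : δ * (x t ⬝ᵥ x t) ≤ x t ⬝ᵥ P *ᵥ x t := by
      by_cases h0 : x t = 0
      · simp [h0]
      · have := hδP _ h0
        rw [one_mulVec] at this
        nlinarith [le_abs_self (x t ⬝ᵥ x t)]
    have h4 : x t i ^ 2 ≤ x t ⬝ᵥ x t := by
      rw [sq]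
      exact Finset.single_le_sum (f := fun i => x t i * x t i)
        (fun j _ => mul_self_nonneg _) (Finset.mem_univ i)
    rw [inv_mul_eq_div, le_div_iff₀ hδ, mul_comm]
    nlinarith
  refine tendsto_pi_nhds.2 fun i => ?_
  have hsq : Tendsto (fun t => x t i ^ 2) atTop (𝓝 0) := by
    have hlim : Tendsto (fun t => δ⁻¹ * (Real.exp (-(ε * t)) * (x 0 ⬝ᵥ P *ᵥ x 0))) atTop (𝓝 0) := by
      have h1 : Tendsto (fun t : ℝ => Real.exp (-(ε * t))) atTop (𝓝 0) :=
        Real.tendsto_exp_neg_atTop_nhds_zero.comp (tendsto_id.const_mul_atTop hε)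
      simpa using (h1.mul_const (x 0 ⬝ᵥ P *ᵥ x 0)).const_mul δ⁻¹
    refine squeeze_zero' (Eventually.of_forall fun t => sq_nonneg _) ?_ hlim
    filter_upwards [eventually_ge_atTop 0] with t ht using hbound t ht i
  have h := hsq.sqrt
  simp only [Real.sqrt_sq_eq_abs, Real.sqrt_zero] at h
  exact (tendsto_zero_iff_abs_tendsto_zero _).2 h

theorem tendsto_quadratic_zero {α : Type*} {l : Filter α} (P : Matrix ι ι ℝ) {u v : α → ι → ℝ}
    (hu : Tendsto u l (𝓝 0)) (hv : Tendsto v l (𝓝 0)) :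
    Tendsto (fun k => u k ⬝ᵥ P *ᵥ v k) l (𝓝 0) := by
  have hc : Continuous fun z : (ι → ℝ) × (ι → ℝ) => z.1 ⬝ᵥ P *ᵥ z.2 := by
    simp only [dotProduct, mulVec]; fun_prop
  have h := (hc.tendsto (0, 0)).comp (hu.prodMk_nhds hv)
  simpa [Function.comp_def] using h

variable [DecidableEq ι]

/-- The trajectories `k ↦ exp (k A) v` of the sampled system all tend to zero. -/
def ExpDecay (A : Matrix ι ι ℝ) : Prop :=
  ∀ v, Tendsto (fun k : ℕ => NormedSpace.exp ((k : ℝ) • A) *ᵥ v) atTop (𝓝 0)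

theorem expDecay_of_lyapunov {A P : Matrix ι ι ℝ} (hP : P.PosDef)
    (hL : (-(Aᵀ * P + P * A)).PosDef) : ExpDecay A := fun v =>
  (tendsto_zero_of_lyapunov hP hL
    fun t _ => (hasDerivAt_exp_smul_mulVec A v t).hasDerivWithinAt).comp
    tendsto_natCast_atTop_atTop

/-- Solvability of the Lyapunov equation of a stable matrix. -/
theorem exists_lyapunov_solution {A W : Matrix ι ι ℝ} (hA : ExpDecay A) (hW : W.PosDef) :
    ∃ Y : Matrix ι ι ℝ, Y.PosDef ∧ Aᵀ * Y + Y * A = -W := by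
  let T : Matrix ι ι ℝ →ₗ[ℝ] Matrix ι ι ℝ :=
    { toFun := fun Y => Aᵀ * Y + Y * A
      map_add' := fun X Y => by simp only [Matrix.mul_add, Matrix.add_mul]; abel
      map_smul' := fun a Y => by simp [smul_add] }
  have hder : ∀ (Y : Matrix ι ι ℝ) (u v : ι → ℝ) (t : ℝ), HasDerivAt
      (fun t : ℝ => (NormedSpace.exp (t • A) *ᵥ u) ⬝ᵥ Y *ᵥ (NormedSpace.exp (t • A) *ᵥ v))
      ((NormedSpace.exp (t • A) *ᵥ u) ⬝ᵥ
        (Aᵀ * Y + Y * A) *ᵥ (NormedSpace.exp (t • A) *ᵥ v)) t := fun Y u v t =>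
    hasDerivWithinAt_univ.1 (hasDerivWithinAt_quadratic A Y
      (hasDerivAt_exp_smul_mulVec A u t).hasDerivWithinAt
      (hasDerivAt_exp_smul_mulVec A v t).hasDerivWithinAt)
  -- If AᵀY + YA = 0, the bilinear form Y is constant along pairs of trajectories, and it tends to 0
  -- by stability. In finite dimension, injectivity gives surjectivity.
  have hinj : Function.Injective T := by
    refine (injective_iff_map_eq_zero T).2 fun Y hY => ?_
    have hY' : Aᵀ * Y + Y * A = 0 := hY
    ext i j
    have hconst := is_const_of_deriv_eq_zero
      (fun t => (hder Y (Pi.single i 1) (Pi.single j 1) t).differentiableAt)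
      (fun t => by rw [(hder Y (Pi.single i 1) (Pi.single j 1) t).deriv, hY']; simp)
    have hlim := tendsto_quadratic_zero Y (hA (Pi.single i 1)) (hA (Pi.single j 1))
    have h0 := tendsto_nhds_unique hlim
      (tendsto_const_nhds.congr fun k : ℕ => hconst 0 (k : ℝ))
    simp only [zero_smul, NormedSpace.exp_zero, one_mulVec] at h0
    rw [mulVec_single_one, single_one_dotProduct] at h0
    exact h0.symm
  obtain ⟨Y, hY⟩ := LinearMap.injective_iff_surjective.1 hinj (-W)
  have hY' : Aᵀ * Y + Y * A = -W := hY
  have hWs := (posDef_real_iff.1 hW).1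
  have hsymm : Yᵀ = Y := hinj <| by
    change Aᵀ * Yᵀ + Yᵀ * A = Aᵀ * Y + Y * A
    have := congrArg transpose hY'
    rw [transpose_add, transpose_mul, transpose_mul, transpose_transpose, transpose_neg, hWs] at this
    rw [hY', ← this, add_comm]
  -- The form Y decreases along each trajectory to the limit 0, so its initial value is nonnegative.
  have hpsd : Y.PosSemidef := by
    refine posSemidef_real_iff.2 ⟨hsymm, fun v => ?_⟩
    have hanti : Antitone fun t : ℝ =>
        (NormedSpace.exp (t • A) *ᵥ v) ⬝ᵥ Y *ᵥ (NormedSpace.exp (t • A) *ᵥ v) := by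
      refine antitone_of_hasDerivAt_nonpos (hder Y v v) fun t => ?_
      rw [hY', neg_mulVec, dotProduct_neg]
      refine neg_nonpos.2 ?_
      exact (posSemidef_real_iff.1 hW.posSemidef).2 _
    have hlim := tendsto_quadratic_zero Y (hA v) (hA v)
    have := ge_of_tendsto' (x := atTop) (tendsto_const_nhds (x := v ⬝ᵥ Y *ᵥ v)) (b := 0)
      fun k : ℕ => ?_
    · exact this
    · exact le_of_tendsto hlim (Eventually.of_forall fun k => by
        have := hanti (Nat.cast_nonneg (α := ℝ) k)
        simpa using this)
  refine ⟨Y, posDef_real_iff.2 ⟨hsymm, fun v hv => ?_⟩, hY'⟩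
  -- A vector with vᵀYv = 0 lies in the kernel of Y, so the equation would give vᵀWv = 0.
  refine lt_of_le_of_ne ((posSemidef_real_iff.1 hpsd).2 v) fun h0 => ?_
  have hYv : Y *ᵥ v = 0 := (hpsd.dotProduct_mulVec_zero_iff v).1 (by simpa using h0.symm)
  have h1 := congrArg (fun M => v ⬝ᵥ M *ᵥ v) hY'
  simp only [add_mulVec, neg_mulVec, dotProduct_neg, ← mulVec_mulVec, hYv,
    mulVec_zero, zero_add] at h1
  rw [dotProduct_mulVec_comm_of_symm hsymm, hYv, dotProduct_zero] at h1
  have := (posDef_real_iff.1 hW).2 v hv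
  linarith

end Lyapunov

end DistH2

namespace DistH2

/-! ### From the spectral condition to decay of the exponential -/

section Hurwitz

attribute [local instance] Matrix.linftyOpNormedRing Matrix.linftyOpNormedAlgebra

/-- Root test: by Gelfand's formula ‖aᵏ‖ is eventually at most rᵏ for some r < 1. -/
theorem tendsto_pow_zero_of_spectralRadius_lt_one {𝔸 : Type*} [NormedRing 𝔸] [NormedAlgebra ℂ 𝔸]
    [CompleteSpace 𝔸] {a : 𝔸} (h : spectralRadius ℂ a < 1) :
    Tendsto (fun k : ℕ => a ^ k) atTop (𝓝 0) := by
  obtain ⟨r, hr, hr1⟩ := exists_between h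
  have hlim := spectrum.pow_nnnorm_pow_one_div_tendsto_nhds_spectralRadius a
  have hev := (hlim.eventually_lt_const hr).and (eventually_gt_atTop 0)
  lift r to NNReal using (hr1.trans ENNReal.one_lt_top).ne
  have hr1' : r < 1 := by exact_mod_cast hr1
  have hle : ∀ᶠ k : ℕ in atTop, ‖a ^ k‖ ≤ (r : ℝ) ^ k := by
    filter_upwards [hev] with k hk
    have h1 := ENNReal.rpow_le_rpow hk.1.le (z := (k : ℝ)) (Nat.cast_nonneg k)
    rw [← ENNReal.rpow_mul, one_div, inv_mul_cancel₀ (Nat.cast_ne_zero.2 hk.2.ne'),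
      ENNReal.rpow_one, ENNReal.rpow_natCast] at h1
    have h2 : ‖a ^ k‖₊ ≤ r ^ k := by exact_mod_cast h1
    exact_mod_cast h2
  exact squeeze_zero_norm' hle
    (tendsto_pow_atTop_nhds_zero_of_lt_one r.2 (by exact_mod_cast hr1'))

variable {ι : Type*} [Fintype ι] [DecidableEq ι]

/-- The nontrivial inclusion of the spectral mapping theorem for the matrix exponential. -/
theorem exists_mem_spectrum_of_mem_spectrum_exp {M : Matrix ι ι ℂ} {μ : ℂ}
    (hμ : μ ∈ spectrum ℂ (NormedSpace.exp M)) : ∃ ν ∈ spectrum ℂ M, Complex.exp ν = μ := by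
  have hμ' : Module.End.HasEigenvalue (Matrix.toLin' (NormedSpace.exp M)) μ := by
    rw [Module.End.hasEigenvalue_iff_mem_spectrum, Matrix.spectrum_toLin']
    exact hμ
  have hcomm : Commute (Matrix.toLin' M) (Matrix.toLin' (NormedSpace.exp M)) := by
    have h : M * NormedSpace.exp M = NormedSpace.exp M * M := mul_exp_of_semiconj rfl
    exact (show Commute M (NormedSpace.exp M) from h).map Matrix.toLinAlgEquiv'
  let V := Module.End.eigenspace (Matrix.toLin' (NormedSpace.exp M)) μ
  have hmaps : ∀ x ∈ V, Matrix.toLin' M x ∈ V :=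
    Module.End.mapsTo_genEigenspace_of_comm hcomm.symm μ 1
  have : Nontrivial V := Submodule.nontrivial_iff_ne_bot.2 hμ'
  -- M commutes with exp M and so preserves its μ-eigenspace; an eigenvector w of M inside it is a
  -- common eigenvector.
  obtain ⟨ν, hν⟩ := Module.End.exists_eigenvalue ((Matrix.toLin' M).restrict hmaps)
  obtain ⟨w, hw⟩ := hν.exists_hasEigenvector
  have hw0 : (w : ι → ℂ) ≠ 0 := fun h => hw.2 (Subtype.ext h)
  have hMw : M *ᵥ (w : ι → ℂ) = ν • (w : ι → ℂ) := by
    have := congrArg Subtype.val hw.apply_eq_smul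
    simpa using this
  have hEw : NormedSpace.exp M *ᵥ (w : ι → ℂ) = μ • (w : ι → ℂ) := by
    have := Module.End.mem_eigenspace_iff.1 w.2
    simpa using this
  refine ⟨ν, ?_, ?_⟩
  · rw [← Matrix.spectrum_toLin']
    refine Module.End.HasEigenvalue.mem_spectrum (Module.End.hasEigenvalue_of_hasEigenvector
      (x := (w : ι → ℂ)) ⟨?_, hw0⟩)
    simpa [Module.End.mem_eigenspace_iff] using hMw
  -- The column w intertwines the 1×1 matrix ν with M, hence exp ν with exp M.
  · have hsemi : Matrix.replicateCol Unit (w : ι → ℂ) * Matrix.diagonal (fun _ : Unit => ν)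
        = M * Matrix.replicateCol Unit (w : ι → ℂ) := by
      ext i j
      have := congrFun hMw i
      rw [mul_diagonal, mul_apply]
      simp only [replicateCol_apply]
      simp only [mulVec, dotProduct, Pi.smul_apply, smul_eq_mul] at this
      rw [this, mul_comm]
    have h := mul_exp_of_semiconj hsemi
    rw [Matrix.exp_diagonal] at h
    obtain ⟨i, hi⟩ := Function.ne_iff.1 hw0
    have h1 := congrFun (congrFun h i) ()
    have h2 := congrFun hEw i
    rw [mul_diagonal, mul_apply] at h1
    simp only [replicateCol_apply] at h1
    simp only [mulVec, dotProduct, Pi.smul_apply, smul_eq_mul] at h2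
    rw [h2, mul_comm] at h1
    have h3 := mul_right_cancel₀ hi h1
    rw [← h3, Complex.exp_eq_exp_ℂ, Pi.coe_exp]

/-- At integer times exp(kM) is the k-th power of exp M, whose eigenvalues exp ν have modulus exp(Re
ν) < 1. The limit is taken over ℂ and brought back by real parts. -/
theorem IsHurwitz.expDecay {n : ℕ} {M : Matrix (Fin n) (Fin n) ℝ} (hM : IsHurwitz M) :
    ExpDecay M := by
  intro v
  rcases Nat.eq_zero_or_pos n with rfl | hn
  · exact tendsto_const_nhds.congr fun k => Subsingleton.elim _ _
  have : Nonempty (Fin n) := ⟨⟨0, hn⟩⟩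
  set X : Matrix (Fin n) (Fin n) ℂ := NormedSpace.exp (M.map Complex.ofReal) with hX
  have hrad : spectralRadius ℂ X < 1 := by
    refine spectrum.spectralRadius_lt_of_forall_lt X (r := 1) fun z hz => ?_
    obtain ⟨ν, hν, rfl⟩ := exists_mem_spectrum_of_mem_spectrum_exp hz
    rw [← NNReal.coe_lt_coe, coe_nnnorm, Complex.norm_exp, NNReal.coe_one, Real.exp_lt_one_iff]
    exact hM ν hν
  have hpow := tendsto_pow_zero_of_spectralRadius_lt_one hrad
  have hmap : (NormedSpace.exp M).map Complex.ofReal = X := by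
    have hc : Continuous (Complex.ofRealHom.mapMatrix : Matrix (Fin n) (Fin n) ℝ →+* _) :=
      continuous_id.matrix_map Complex.continuous_ofReal
    exact NormedSpace.map_exp _ hc M
  have hreal : ∀ k : ℕ, ((NormedSpace.exp ((k : ℝ) • M)).map Complex.ofReal) = X ^ k := fun k => by
    rw [Nat.cast_smul_eq_nsmul, Matrix.exp_nsmul, ← hmap]
    exact map_pow (Complex.ofRealHom.mapMatrix : Matrix (Fin n) (Fin n) ℝ →+* _) _ k
  have hexp : Tendsto (fun k : ℕ => NormedSpace.exp ((k : ℝ) • M)) atTop (𝓝 0) := by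
    have hre : Continuous fun Z : Matrix (Fin n) (Fin n) ℂ => Z.map Complex.re :=
      continuous_id.matrix_map Complex.continuous_re
    have h := (hre.tendsto 0).comp hpow
    have h0 : (0 : Matrix (Fin n) (Fin n) ℂ).map Complex.re = 0 := by ext; simp
    rw [h0] at h
    refine h.congr fun k => ?_
    rw [Function.comp_apply, ← hreal]
    ext i j
    simp
  have hc : Continuous fun Z : Matrix (Fin n) (Fin n) ℝ => Z *ᵥ v :=
    continuous_id.matrix_mulVec continuous_const
  have h := (hc.tendsto 0).comp hexp
  rwa [zero_mulVec] at h

end Hurwitz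

/-! ### Strict Riccati inequalities from stabilizability -/

section Riccati

theorem quadratic_lyapunov {ι : Type*} [Fintype ι] {A P : Matrix ι ι ℝ} (hP : Pᵀ = P)
    (v : ι → ℝ) : v ⬝ᵥ (Aᵀ * P + P * A) *ᵥ v = 2 * (v ⬝ᵥ P *ᵥ A *ᵥ v) := by
  rw [add_mulVec, dotProduct_add, ← mulVec_mulVec, ← mulVec_mulVec, ← mulVec_dotProduct,
    dotProduct_mulVec_comm_of_symm hP]
  ring

theorem dotProduct_self_nonneg {ι : Type*} [Fintype ι] (v : ι → ℝ) : 0 ≤ v ⬝ᵥ v :=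
  Finset.sum_nonneg fun i _ => mul_self_nonneg (v i)

theorem quadratic_gram {ι κ : Type*} [Fintype ι] [Fintype κ] (K : Matrix κ ι ℝ) (v : ι → ℝ) :
    v ⬝ᵥ (Kᵀ * K) *ᵥ v = (K *ᵥ v) ⬝ᵥ (K *ᵥ v) := by
  rw [← mulVec_mulVec, mulVec_dotProduct]

variable {n m : ℕ} {A : Matrix (Fin n) (Fin n) ℝ} {B : Matrix (Fin n) (Fin m) ℝ}

/-- Stabilizable pairs admit solutions of strict Riccati inequalities. -/
theorem Stabilizable.exists_riccati (h : Stabilizable A B) {κ : ℝ} (hκ : κ < 0)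
    {R : Matrix (Fin n) (Fin n) ℝ} (hR : Rᵀ = R) :
    ∃ P : Matrix (Fin n) (Fin n) ℝ, P.PosDef ∧
      NegDef (Aᵀ * P + P * A + κ • (P * B * Bᵀ * P) + R) := by
  obtain ⟨K, hK⟩ := h
  obtain ⟨X, hX, hXeq⟩ := exists_lyapunov_solution hK.expDecay
    (Matrix.PosDef.one (n := Fin n) (R := ℝ))
  have hXs := (posDef_real_iff.1 hX).1
  obtain ⟨ε, hε, hεK⟩ := exists_pos_mul_abs_lt (Matrix.PosDef.one (n := Fin n) (R := ℝ)) (Kᵀ * K)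
  obtain ⟨δ, hδ, hδR⟩ := exists_pos_mul_abs_lt (Matrix.PosDef.one (n := Fin n) (R := ℝ)) R
  -- P = τX, where X solves the Lyapunov equation of A + BK. Young's inequality with σ bounds the
  -- cross term of a = Kv and b = BᵀXv, with |a|²/σ < |v|²/2. A large τ absorbs R into the remaining
  -- |v|²/2, and σ|b|² into the quadratic term κτ|b|².
  set σ : ℝ := 2 / ε with hσ
  set τ : ℝ := max (2 / δ) (σ / -κ) with hτ
  have hσ0 : 0 < σ := by positivity
  have hτ0 : 0 < τ := lt_max_of_lt_left (by positivity)
  have hτκ : σ + κ * τ ≤ 0 := by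
    have : σ / -κ ≤ τ := le_max_right _ _
    rw [div_le_iff₀ (by linarith)] at this
    linarith
  have hPs : (τ • X)ᵀ = τ • X := by rw [transpose_smul, hXs]
  refine ⟨τ • X, hX.smul hτ0, posDef_real_iff.2 ⟨?_, fun v hv => ?_⟩⟩
  · simp only [transpose_neg, transpose_add, transpose_mul, transpose_smul, transpose_transpose,
      hXs, hR, Matrix.mul_assoc]
    rw [add_comm (_ * A)]
  have h1 := quadratic_lyapunov (A := A + B * K) hXs v
  rw [hXeq, neg_mulVec, one_mulVec, dotProduct_neg, add_mulVec, mulVec_add, dotProduct_add,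
    ← mulVec_mulVec] at h1
  set a := K *ᵥ v with ha
  set b := Bᵀ *ᵥ X *ᵥ v with hb
  have hab : v ⬝ᵥ X *ᵥ B *ᵥ a = b ⬝ᵥ a := by
    rw [hb, mulVec_dotProduct, mulVec_dotProduct, transpose_transpose, hXs]
  have h2 : v ⬝ᵥ (τ • X * B * Bᵀ * τ • X) *ᵥ v = τ ^ 2 * (b ⬝ᵥ b) := by
    have hM : τ • X * B * Bᵀ * τ • X = τ ^ 2 • ((Bᵀ * X)ᵀ * (Bᵀ * X)) := by
      simp only [transpose_mul, transpose_transpose, hXs, Matrix.smul_mul, Matrix.mul_smul, smul_smul,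
        Matrix.mul_assoc, sq]
    rw [hM, smul_mulVec, dotProduct_smul, quadratic_gram, ← mulVec_mulVec, smul_eq_mul]
  have h3 := hεK v hv
  rw [quadratic_gram, one_mulVec, ← ha, abs_of_nonneg (dotProduct_self_nonneg _)] at h3
  have h4 := hδR v hv
  rw [one_mulVec] at h4
  have h5 : v ⬝ᵥ R *ᵥ v ≤ τ / 2 * (v ⬝ᵥ v) := by
    have : 2 / δ ≤ τ := le_max_left _ _
    rw [div_le_iff₀ hδ] at this
    nlinarith [le_abs_self (v ⬝ᵥ R *ᵥ v), dotProduct_self_nonneg v]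
  have h6 : 0 ≤ σ ^ 2 * (b ⬝ᵥ b) + 2 * σ * (b ⬝ᵥ a) + a ⬝ᵥ a := by
    have := dotProduct_self_nonneg (σ • b + a)
    simp only [add_dotProduct, dotProduct_add, smul_dotProduct, dotProduct_smul, smul_eq_mul,
      dotProduct_comm a b] at this
    linarith
  rw [neg_mulVec, dotProduct_neg, neg_pos, add_mulVec, dotProduct_add, add_mulVec, dotProduct_add,
    quadratic_lyapunov hPs, smul_mulVec, dotProduct_smul, smul_mulVec, dotProduct_smul, h2,
    smul_eq_mul, smul_eq_mul]
  have h7 : v ⬝ᵥ X *ᵥ A *ᵥ v = -(v ⬝ᵥ v) / 2 - b ⬝ᵥ a := by linarith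
  have h8 : a ⬝ᵥ a / σ < v ⬝ᵥ v / 2 := by
    rw [hσ, div_div_eq_mul_div, mul_comm]
    linarith
  have h9 : -(2 * (b ⬝ᵥ a)) ≤ σ * (b ⬝ᵥ b) + a ⬝ᵥ a / σ := by
    rw [← sub_nonneg]
    have : σ * (b ⬝ᵥ b) + a ⬝ᵥ a / σ - -(2 * (b ⬝ᵥ a))
        = (σ ^ 2 * (b ⬝ᵥ b) + 2 * σ * (b ⬝ᵥ a) + a ⬝ᵥ a) / σ := by field_simp; ring
    rw [this]
    positivity
  have h10 : τ * (σ + κ * τ) * (b ⬝ᵥ b) ≤ 0 :=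
    mul_nonpos_of_nonpos_of_nonneg (mul_nonpos_of_nonneg_of_nonpos hτ0.le hτκ)
      (dotProduct_self_nonneg b)
  have h11 : τ * (2 * (v ⬝ᵥ X *ᵥ A *ᵥ v)) < τ * (-(v ⬝ᵥ v) + σ * (b ⬝ᵥ b) + v ⬝ᵥ v / 2) :=
    mul_lt_mul_of_pos_left (by rw [h7]; linarith) hτ0
  nlinarith

end Riccati

end DistH2

namespace DistH2

/-! ### Bounding the H₂ norm by Lyapunov supersolutions -/

section Gramian

variable {ι κ ρ : Type*} [Fintype ι] [Fintype κ] [Fintype ρ]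

theorem trace_transpose_mul_self (T : Matrix ρ κ ℝ) :
    (Tᵀ * T).trace = ∑ i, T i ⬝ᵥ T i := by
  simp only [trace, diag_apply, mul_apply, transpose_apply, dotProduct]
  exact Finset.sum_comm

theorem trace_mul_mul_transpose (C : Matrix ρ ι ℝ) (Y : Matrix ι ι ℝ) :
    (C * Y * Cᵀ).trace = ∑ i, C i ⬝ᵥ Y *ᵥ C i := by
  simp only [trace, diag_apply]
  refine Finset.sum_congr rfl fun i _ => ?_
  rw [Matrix.mul_assoc]
  simp only [mul_apply, dotProduct, mulVec, transpose_apply]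

variable [DecidableEq ι]

/-- A supersolution of the Lyapunov equation dominates the Gramian, in one direction. -/
theorem integral_quadratic_le_of_lyapunov {A Y : Matrix ι ι ℝ} {E : Matrix ι κ ℝ}
    (hY : Y.PosSemidef) (hL : (-(A * Y + Y * Aᵀ + E * Eᵀ)).PosSemidef) (c : ι → ℝ) :
    IntegrableOn (fun t : ℝ => (Eᵀ *ᵥ (NormedSpace.exp (t • Aᵀ) *ᵥ c)) ⬝ᵥ
        (Eᵀ *ᵥ (NormedSpace.exp (t • Aᵀ) *ᵥ c))) (Ioi 0) ∧
      ∫ t in Ioi (0 : ℝ), (Eᵀ *ᵥ (NormedSpace.exp (t • Aᵀ) *ᵥ c)) ⬝ᵥ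
        (Eᵀ *ᵥ (NormedSpace.exp (t • Aᵀ) *ᵥ c)) ≤ c ⬝ᵥ Y *ᵥ c := by
  set u : ℝ → ι → ℝ := fun t => NormedSpace.exp (t • Aᵀ) *ᵥ c with hu
  have hud : ∀ t, HasDerivAt u (Aᵀ *ᵥ u t) t := fun t => hasDerivAt_exp_smul_mulVec Aᵀ c t
  have huc : Continuous u := continuous_iff_continuousAt.2 fun t => (hud t).continuousAt
  have hquad : ∀ M : Matrix ι ι ℝ, Continuous fun t => u t ⬝ᵥ M *ᵥ u t := fun M => by
    simp only [dotProduct, mulVec]; fun_prop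
  have hg : Continuous fun t => (Eᵀ *ᵥ u t) ⬝ᵥ (Eᵀ *ᵥ u t) := by
    simp only [dotProduct, mulVec]; fun_prop
  have hV : ∀ t, HasDerivAt (fun t => u t ⬝ᵥ Y *ᵥ u t) (u t ⬝ᵥ (A * Y + Y * Aᵀ) *ᵥ u t) t :=
    fun t => by
      have h := hasDerivWithinAt_quadratic Aᵀ Y (hud t).hasDerivWithinAt
        (hud t).hasDerivWithinAt (s := univ)
      rw [transpose_transpose] at h
      exact hasDerivWithinAt_univ.1 h
  have hle : ∀ t, (Eᵀ *ᵥ u t) ⬝ᵥ (Eᵀ *ᵥ u t) ≤ -(u t ⬝ᵥ (A * Y + Y * Aᵀ) *ᵥ u t) := fun t => by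
    have h := (posSemidef_real_iff.1 hL).2 (u t)
    have h2 := quadratic_gram Eᵀ (u t)
    rw [transpose_transpose] at h2
    rw [neg_mulVec, dotProduct_neg, add_mulVec, dotProduct_add, h2] at h
    linarith
  -- The integrand is at most -V' for V = uᵀYu; integrate over [0, T] and drop V(T) ≥ 0.
  have hbound : ∀ T, 0 ≤ T → ∫ t in (0 : ℝ)..T, (Eᵀ *ᵥ u t) ⬝ᵥ (Eᵀ *ᵥ u t) ≤ c ⬝ᵥ Y *ᵥ c := by
    intro T hT
    have h1 : ∫ t in (0 : ℝ)..T, (Eᵀ *ᵥ u t) ⬝ᵥ (Eᵀ *ᵥ u t) ≤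
        ∫ t in (0 : ℝ)..T, -(u t ⬝ᵥ (A * Y + Y * Aᵀ) *ᵥ u t) :=
      intervalIntegral.integral_mono_on hT (hg.intervalIntegrable 0 T)
        ((hquad (A * Y + Y * Aᵀ)).neg.intervalIntegrable 0 T) fun t _ => hle t
    rw [intervalIntegral.integral_neg, intervalIntegral.integral_eq_sub_of_hasDerivAt
      (fun t _ => hV t) ((hquad _).intervalIntegrable 0 T)] at h1
    have h2 : u 0 = c := by simp [hu]
    have h3 := (posSemidef_real_iff.1 hY).2 (u T)
    rw [h2] at h1
    linarith
  have hint : IntegrableOn (fun t => (Eᵀ *ᵥ u t) ⬝ᵥ (Eᵀ *ᵥ u t)) (Ioi 0) := by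
    refine integrableOn_Ioi_of_intervalIntegral_norm_bounded (c ⬝ᵥ Y *ᵥ c) 0
      (fun T => (hg.integrableOn_Icc (a := 0) (b := T)).mono_set Ioc_subset_Icc_self)
      tendsto_id ?_
    filter_upwards [eventually_ge_atTop 0] with T hT
    simp only [Real.norm_of_nonneg (dotProduct_self_nonneg _)]
    exact hbound T hT
  refine ⟨hint, le_of_tendsto (intervalIntegral_tendsto_integral_Ioi 0 hint tendsto_id) ?_⟩
  filter_upwards [eventually_ge_atTop 0] with T hT using hbound T hT

/-- A supersolution `Y` of the Lyapunov equation bounds the squared `H₂` norm of the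
system `(A, E, C)` by `tr (C Y Cᵀ)`. -/
theorem integral_trace_le_of_lyapunov {A Y : Matrix ι ι ℝ} {E : Matrix ι κ ℝ}
    (C : Matrix ρ ι ℝ) (hY : Y.PosSemidef)
    (hL : (-(A * Y + Y * Aᵀ + E * Eᵀ)).PosSemidef) :
    IntegrableOn (fun t : ℝ => ((C * NormedSpace.exp (t • A) * E)ᵀ *
        (C * NormedSpace.exp (t • A) * E)).trace) (Ioi 0) ∧
      ∫ t in Ioi (0 : ℝ), ((C * NormedSpace.exp (t • A) * E)ᵀ *
        (C * NormedSpace.exp (t • A) * E)).trace ≤ (C * Y * Cᵀ).trace := by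
  have hrow : ∀ t : ℝ, ((C * NormedSpace.exp (t • A) * E)ᵀ *
      (C * NormedSpace.exp (t • A) * E)).trace =
      ∑ i, (Eᵀ *ᵥ (NormedSpace.exp (t • Aᵀ) *ᵥ C i)) ⬝ᵥ
        (Eᵀ *ᵥ (NormedSpace.exp (t • Aᵀ) *ᵥ C i)) := fun t => by
    rw [trace_transpose_mul_self]
    refine Finset.sum_congr rfl fun i _ => ?_
    rw [mul_apply_eq_vecMul, mul_apply_eq_vecMul, ← transpose_smul, Matrix.exp_transpose,
      mulVec_transpose, mulVec_transpose]
  simp only [hrow]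
  have h := fun i => integral_quadratic_le_of_lyapunov hY hL (C i)
  refine ⟨integrable_finsetSum _ fun i _ => (h i).1, ?_⟩
  rw [integral_finsetSum _ fun i _ => (h i).1, trace_mul_mul_transpose]
  exact Finset.sum_le_sum fun i _ => (h i).2

/-- With Y = BᴴB, the trace is that of the positive semidefinite matrix BMBᴴ. -/
theorem trace_mul_nonneg {M Y : Matrix ι ι ℝ} (hM : M.PosSemidef) (hY : Y.PosSemidef) :
    0 ≤ (M * Y).trace := by
  open scoped MatrixOrder in
  obtain ⟨B, rfl⟩ := CStarAlgebra.nonneg_iff_eq_star_mul_self.mp hY.nonneg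
  rw [star_eq_conjTranspose]
  rw [← Matrix.mul_assoc, trace_mul_comm, ← Matrix.mul_assoc]
  exact (hM.mul_mul_conjTranspose_same B).trace_nonneg

/-- Congruence by P⁻¹ exchanges the Lyapunov inequality with its dual form. -/
theorem posDef_lyapunov_inv {A P : Matrix ι ι ℝ} (hP : P.PosDef)
    (hL : (-(Aᵀ * P + P * A)).PosDef) : (-(A * P⁻¹ + P⁻¹ * Aᵀ)).PosDef := by
  have h := posDef_congr_inv hP hL
  have hu := (Matrix.isUnit_iff_isUnit_det P).1 hP.isUnit
  convert h using 1
  rw [Matrix.mul_neg, Matrix.neg_mul, Matrix.mul_add, Matrix.add_mul, ← Matrix.mul_assoc P⁻¹ P A,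
    nonsing_inv_mul _ hu, Matrix.one_mul, Matrix.mul_assoc, Matrix.mul_assoc Aᵀ P,
    mul_nonsing_inv _ hu, Matrix.mul_one, add_comm]

end Gramian

/-! ### A single mode: separation of estimation and control -/

section Modes

variable {n m q r p : ℕ} (S : Agent n m q r p) (F : Matrix (Fin m) (Fin n) ℝ)
  (G : Matrix (Fin n) (Fin r) ℝ) (l : ℝ)

/-- System matrix of the network mode of the Laplacian eigenvalue `l`. -/
def modeA : Matrix (Fin n ⊕ Fin n) (Fin n ⊕ Fin n) ℝ :=
  fromBlocks S.A (S.B * F) (l • (G * S.C₁)) (S.A - G * S.C₁ + l • (S.B * F))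

/-- Disturbance input matrix of the network mode of the Laplacian eigenvalue `l`. -/
def modeE : Matrix (Fin n ⊕ Fin n) (Fin q) ℝ :=
  fromRows S.E (l • (G * S.D₁))

/-- Output matrix of every network mode. -/
def modeC : Matrix (Fin p) (Fin n ⊕ Fin n) ℝ :=
  fromCols S.C₂ (S.D₂ * F)

/-- The covariance `(x̂ + e, l x̂)` of a mode for uncorrelated `x̂`, `e` of covariances `Y`, `Q`. -/
def modeCov (l : ℝ) (Q Y : Matrix (Fin n) (Fin n) ℝ) : Matrix (Fin n ⊕ Fin n) (Fin n ⊕ Fin n) ℝ :=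
  fromBlocks (Y + Q) (l • Y) (l • Y) (l ^ 2 • Y)

theorem neg_modeCov (Q Y : Matrix (Fin n) (Fin n) ℝ) :
    -modeCov l Q Y = modeCov l (-Q) (-Y) := by
  simp [modeCov, fromBlocks_neg, add_comm]

variable {l}

theorem posDef_modeCov (hl : l ≠ 0) {Q Y : Matrix (Fin n) (Fin n) ℝ} (hQ : Q.PosDef)
    (hY : Y.PosDef) : (modeCov l Q Y).PosDef := by
  have hYs := (posDef_real_iff.1 hY).1
  have hQs := (posDef_real_iff.1 hQ).1
  refine posDef_real_iff.2 ⟨by simp [modeCov, fromBlocks_transpose, hYs, hQs], fun x hx => ?_⟩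
  obtain ⟨a, b, rfl⟩ : ∃ a b : Fin n → ℝ, x = Sum.elim a b :=
    ⟨x ∘ Sum.inl, x ∘ Sum.inr, (Sum.elim_comp_inl_inr x).symm⟩
  -- In the coordinates a + lb and a the form is block diagonal, with blocks Y and Q.
  have hquad : Sum.elim a b ⬝ᵥ modeCov l Q Y *ᵥ Sum.elim a b =
      (a + l • b) ⬝ᵥ Y *ᵥ (a + l • b) + a ⬝ᵥ Q *ᵥ a := by
    rw [modeCov, fromBlocks_mulVec, sumElim_dotProduct_sumElim]
    simp only [add_mulVec, smul_mulVec, mulVec_add, mulVec_smul, dotProduct_add, add_dotProduct,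
      dotProduct_smul, smul_dotProduct, smul_eq_mul, Sum.elim_comp_inl, Sum.elim_comp_inr]
    ring
  rw [hquad]
  by_cases ha : a = 0
  · subst ha
    have hb : l • b ≠ 0 := by
      refine smul_ne_zero hl ?_
      rintro rfl
      exact hx (by ext (i | i) <;> rfl)
    simpa using (posDef_real_iff.1 hY).2 _ hb
  · exact add_pos_of_nonneg_of_pos ((posSemidef_real_iff.1 hY.posSemidef).2 _)
      ((posDef_real_iff.1 hQ).2 _ ha)

variable {S F}

/-- The cross term of e and x̂ is QC₁ᵀGᵀ from the dynamics and -GGᵀ from the shared noise D₁d; the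
two cancel exactly for G = QC₁ᵀ. -/
theorem modeA_lyapunov {Q Y : Matrix (Fin n) (Fin n) ℝ} (hQ : Qᵀ = Q)
    (hDE : S.D₁ * S.Eᵀ = 0) (hD₁ : S.D₁ * S.D₁ᵀ = 1) :
    modeA S F (Q * S.C₁ᵀ) l * modeCov l Q Y + modeCov l Q Y * (modeA S F (Q * S.C₁ᵀ) l)ᵀ +
        modeE S (Q * S.C₁ᵀ) l * (modeE S (Q * S.C₁ᵀ) l)ᵀ =
      modeCov l (S.A * Q + Q * S.Aᵀ - Q * S.C₁ᵀ * S.C₁ * Q + S.E * S.Eᵀ)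
        ((S.A + l • (S.B * F)) * Y + Y * (S.A + l • (S.B * F))ᵀ +
          (Q * S.C₁ᵀ) * (Q * S.C₁ᵀ)ᵀ) := by
  have hED : S.E * S.D₁ᵀ = 0 := by
    have := congrArg transpose hDE
    simpa [transpose_mul] using this
  have hED' : ∀ X : Matrix (Fin r) (Fin n) ℝ, S.E * (S.D₁ᵀ * X) = 0 := fun X => by
    rw [← Matrix.mul_assoc, hED, Matrix.zero_mul]
  have hD₁' : ∀ X : Matrix (Fin r) (Fin n) ℝ, S.D₁ * (S.D₁ᵀ * X) = X := fun X => by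
    rw [← Matrix.mul_assoc, hD₁, Matrix.one_mul]
  simp only [modeA, modeCov, modeE, fromBlocks_transpose, transpose_fromRows,
    fromBlocks_multiply, fromRows_mul_fromCols, fromBlocks_add]
  congr 1 <;>
  · simp only [transpose_add, transpose_sub, transpose_mul, transpose_smul, transpose_transpose,
      hQ, Matrix.add_mul, Matrix.mul_add, Matrix.sub_mul, Matrix.mul_sub, Matrix.smul_mul,
      Matrix.mul_smul, Matrix.mul_assoc, hDE, hED', hD₁', Matrix.mul_zero, smul_zero]
    module

theorem trace_fromBlocks {ι κ : Type*} [Fintype ι] [Fintype κ] (A : Matrix ι ι ℝ)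
    (B : Matrix ι κ ℝ) (C : Matrix κ ι ℝ) (D : Matrix κ κ ℝ) :
    (fromBlocks A B C D).trace = A.trace + D.trace := by
  simp [trace, Fintype.sum_sum_type]

/-- Orthogonality of C₂ and D₂ makes the output Gram matrix block diagonal. -/
theorem trace_modeC {Q Y : Matrix (Fin n) (Fin n) ℝ} (hDC : S.D₂ᵀ * S.C₂ = 0)
    (hD₂ : S.D₂ᵀ * S.D₂ = 1) :
    (modeC S F * modeCov l Q Y * (modeC S F)ᵀ).trace =
      (S.C₂ * Q * S.C₂ᵀ).trace + ((S.C₂ᵀ * S.C₂ + l ^ 2 • (Fᵀ * F)) * Y).trace := by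
  have hCD : S.C₂ᵀ * S.D₂ = 0 := by
    have := congrArg transpose hDC
    simpa [transpose_mul] using this
  have hgram : (modeC S F)ᵀ * modeC S F =
      fromBlocks (S.C₂ᵀ * S.C₂) 0 0 (Fᵀ * F) := by
    rw [modeC, transpose_fromCols, fromRows_mul_fromCols]
    congr 1
    · rw [← Matrix.mul_assoc, hCD, Matrix.zero_mul]
    · rw [transpose_mul, Matrix.mul_assoc, hDC, Matrix.mul_zero]
    · rw [transpose_mul, Matrix.mul_assoc, ← Matrix.mul_assoc S.D₂ᵀ, hD₂, Matrix.one_mul]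
  rw [trace_mul_comm, ← Matrix.mul_assoc, hgram, modeCov, fromBlocks_multiply, trace_mul_comm (S.C₂ * Q),
    ← Matrix.mul_assoc, trace_fromBlocks]
  simp only [Matrix.zero_mul, add_zero, zero_add, Matrix.mul_add, Matrix.add_mul, Matrix.mul_smul,
    Matrix.smul_mul, trace_add, smul_zero]
  ring

theorem tendsto_zero_of_modeCov {ι κ : Type*} [Fintype ι] [Fintype κ] [DecidableEq ι]
    {A Y : Matrix ι ι ℝ} {E : Matrix ι κ ℝ} (hY : Y.PosDef)
    (hL : (-(A * Y + Y * Aᵀ + E * Eᵀ)).PosDef) {x : ℝ → ι → ℝ}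
    (hx : ∀ t ∈ Ici (0 : ℝ), HasDerivWithinAt x (A *ᵥ x t) (Ici 0) t) :
    Tendsto x atTop (𝓝 0) := by
  have h : (-(Aᵀᵀ * Y + Y * Aᵀ)).PosDef := by
    convert hL.add_posSemidef (posSemidef_self_mul_conjTranspose E) using 1
    rw [conjTranspose_eq_transpose_of_trivial, transpose_transpose]
    abel
  have h2 := posDef_lyapunov_inv hY h
  rw [transpose_transpose, add_comm] at h2
  refine tendsto_zero_of_lyapunov hY.inv ?_ hx
  rwa [add_comm]

/-- The designed gains admit, for each relevant Laplacian eigenvalue, a supersolution of the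
Lyapunov equation of the mode with small output trace. -/
theorem exists_modeCov (hDE : S.D₁ * S.Eᵀ = 0) (hDC : S.D₂ᵀ * S.C₂ = 0)
    (hD₁ : S.D₁ * S.D₁ᵀ = 1) (hD₂ : S.D₂ᵀ * S.D₂ = 1)
    {Q : Matrix (Fin n) (Fin n) ℝ} (hQ : Q.PosDef)
    (hQric : NegDef (S.A * Q + Q * S.Aᵀ - Q * S.C₁ᵀ * S.C₁ * Q + S.E * S.Eᵀ))
    {c κ Λ β : ℝ} (hl : 0 < l) (hlΛ : l ≤ Λ) (hκ : c ^ 2 * l ^ 3 - 2 * c * l ≤ κ)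
    {P : Matrix (Fin n) (Fin n) ℝ} (hP : P.PosDef)
    (hPric : NegDef (S.Aᵀ * P + P * S.A + κ • (P * S.B * S.Bᵀ * P) + Λ • (S.C₂ᵀ * S.C₂)))
    (hβ : (S.C₁ * Q * P * Q * S.C₁ᵀ).trace + Λ * (S.C₂ * Q * S.C₂ᵀ).trace < β) :
    ∃ Y : Matrix (Fin n ⊕ Fin n) (Fin n ⊕ Fin n) ℝ, Y.PosDef ∧
      (-(modeA S (-(c • (S.Bᵀ * P))) (Q * S.C₁ᵀ) l * Y
        + Y * (modeA S (-(c • (S.Bᵀ * P))) (Q * S.C₁ᵀ) l)ᵀ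
        + modeE S (Q * S.C₁ᵀ) l * (modeE S (Q * S.C₁ᵀ) l)ᵀ)).PosDef ∧
      l * (modeC S (-(c • (S.Bᵀ * P))) * Y * (modeC S (-(c • (S.Bᵀ * P))))ᵀ).trace < β := by
  have hPs := (posDef_real_iff.1 hP).1
  have hQs := (posDef_real_iff.1 hQ).1
  set F : Matrix (Fin m) (Fin n) ℝ := -(c • (S.Bᵀ * P)) with hF
  set G : Matrix (Fin n) (Fin r) ℝ := Q * S.C₁ᵀ with hG
  set Al := S.A + l • (S.B * F) with hAl
  have hFF : Fᵀ * F = c ^ 2 • (P * S.B * S.Bᵀ * P) := by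
    simp only [hF, transpose_neg, transpose_smul, transpose_mul, transpose_transpose, hPs,
      Matrix.neg_mul, Matrix.mul_neg, Matrix.smul_mul, Matrix.mul_smul, Matrix.mul_assoc]
    module
  have hFFpsd : (Fᵀ * F).PosSemidef := by
    have := posSemidef_conjTranspose_mul_self F
    rwa [conjTranspose_eq_transpose_of_trivial] at this
  have hPBpsd : (P * S.B * S.Bᵀ * P).PosSemidef := by
    have := posSemidef_conjTranspose_mul_self (S.Bᵀ * P)
    simpa only [conjTranspose_eq_transpose_of_trivial, transpose_mul, transpose_transpose, hPs,
      Matrix.mul_assoc] using this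
  have hCCpsd : (S.C₂ᵀ * S.C₂).PosSemidef := by
    have := posSemidef_conjTranspose_mul_self S.C₂
    rwa [conjTranspose_eq_transpose_of_trivial] at this
  have hAlP : Alᵀ * P + P * Al = S.Aᵀ * P + P * S.A - (2 * c * l) • (P * S.B * S.Bᵀ * P) := by
    simp only [hAl, hF, transpose_add, transpose_neg, transpose_smul, transpose_mul,
      transpose_transpose, hPs, Matrix.neg_mul, Matrix.mul_neg, Matrix.smul_mul, Matrix.mul_smul,
      Matrix.add_mul, Matrix.mul_add, Matrix.mul_assoc]
    module
  -- Replacing κ by c²l³ - 2cl and Λ by l only subtracts positive semidefinite terms from the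
  -- Riccati expression.
  have hM : (-(Alᵀ * P + P * Al + (l ^ 3 • (Fᵀ * F) + l • (S.C₂ᵀ * S.C₂)))).PosDef := by
    convert (hPric.add_posSemidef (hPBpsd.smul (sub_nonneg.2 hκ))).add_posSemidef
      (hCCpsd.smul (sub_nonneg.2 hlΛ)) using 1
    rw [hAlP, hFF]
    module
  have hMl : (-(Alᵀ * P + P * Al)).PosDef := by
    convert hM.add_posSemidef ((hFFpsd.smul (by positivity : 0 ≤ l ^ 3)).add
      (hCCpsd.smul hl.le)) using 1
    abel
  have hdec : ExpDecay Alᵀ := by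
    refine expDecay_of_lyapunov hP.inv ?_
    rw [transpose_transpose]
    exact posDef_lyapunov_inv hP hMl
  set gap := β - ((S.C₁ * Q * P * Q * S.C₁ᵀ).trace + Λ * (S.C₂ * Q * S.C₂ᵀ).trace) with hgap
  have hgap0 : 0 < gap := sub_pos.2 hβ
  have htrP : 0 ≤ P.trace := hP.posSemidef.trace_nonneg
  -- Solving the equation for Y with the extra noise δI makes its inequality strict at the price δ
  -- tr P, which stays below the gap.
  set δ := gap / (P.trace + 1) with hδ
  have hδ0 : 0 < δ := by positivity
  have hGG : (G * Gᵀ).PosSemidef := by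
    have := posSemidef_self_mul_conjTranspose G
    rwa [conjTranspose_eq_transpose_of_trivial] at this
  have hW : (δ • (1 : Matrix (Fin n) (Fin n) ℝ) + G * Gᵀ).PosDef :=
    (Matrix.PosDef.one.smul hδ0).add_posSemidef hGG
  obtain ⟨Y, hY, hYeq⟩ := exists_lyapunov_solution hdec hW
  rw [transpose_transpose] at hYeq
  refine ⟨modeCov l Q Y, posDef_modeCov hl.ne' hQ hY, ?_, ?_⟩
  · rw [modeA_lyapunov hQs hDE hD₁, neg_modeCov]
    refine posDef_modeCov hl.ne' hQric ?_
    rw [← hAl, ← hG, hYeq]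
    convert (Matrix.PosDef.one (n := Fin n) (R := ℝ)).smul hδ0 using 1
    abel
  · rw [trace_modeC hDC hD₂, mul_add]
    have h1 := trace_mul_nonneg hM.posSemidef hY.posSemidef
    rw [Matrix.neg_mul, trace_neg, Matrix.add_mul, trace_add] at h1
    -- Duality: moving the Lyapunov operator from P to Y in the trace pairing.
    have h2 : ((Alᵀ * P + P * Al) * Y).trace = -(δ * P.trace + (P * (G * Gᵀ)).trace) := by
      have h3 : ((Alᵀ * P + P * Al) * Y).trace = (P * (Al * Y + Y * Alᵀ)).trace := by
        rw [Matrix.add_mul, Matrix.mul_add P (Al * Y), trace_add, trace_add, Matrix.mul_assoc Alᵀ,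
          trace_mul_comm Alᵀ, Matrix.mul_assoc, Matrix.mul_assoc, add_comm]
      rw [h3, hYeq, Matrix.mul_neg, trace_neg, Matrix.mul_add, trace_add, Matrix.mul_smul,
        Matrix.mul_one, trace_smul, smul_eq_mul]
    have h4 : (P * (G * Gᵀ)).trace = (S.C₁ * Q * P * Q * S.C₁ᵀ).trace := by
      rw [hG, transpose_mul, transpose_transpose, hQs, trace_mul_comm, Matrix.mul_assoc,
        trace_mul_comm, ← Matrix.mul_assoc]
    have h5 : l * ((S.C₂ᵀ * S.C₂ + l ^ 2 • (Fᵀ * F)) * Y).trace =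
        ((l ^ 3 • (Fᵀ * F) + l • (S.C₂ᵀ * S.C₂)) * Y).trace := by
      rw [← smul_eq_mul, ← trace_smul, ← Matrix.smul_mul]
      congr 2
      module
    have h6 : 0 ≤ (S.C₂ * Q * S.C₂ᵀ).trace := by
      have := (hQ.posSemidef.mul_mul_conjTranspose_same S.C₂).trace_nonneg
      rwa [conjTranspose_eq_transpose_of_trivial] at this
    have h7 : δ * P.trace < gap := by
      rw [hδ, div_mul_eq_mul_div, div_lt_iff₀ (by positivity)]
      nlinarith
    have h8 := mul_le_mul_of_nonneg_right hlΛ h6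
    rw [h5]
    linarith

end Modes

end DistH2

namespace DistH2

/-! ### Incidence matrix, Laplacian and connectedness -/

namespace WeightedGraph

variable {N K : ℕ} {g : WeightedGraph N}

namespace EdgeOrientation

variable (o : g.EdgeOrientation K)

/-- The edge `k` joins the nodes `i` and `j`. -/
def Joins (k : Fin K) (i j : Fin N) : Prop :=
  (o.src k = i ∧ o.tgt k = j) ∨ (o.src k = j ∧ o.tgt k = i)

instance (k : Fin K) (i j : Fin N) : Decidable (o.Joins k i j) := by
  unfold Joins; infer_instance

theorem src_ne_tgt (k : Fin K) : o.src k ≠ o.tgt k := fun h => by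
  have := o.isEdge k
  rw [h, g.loopless] at this
  exact lt_irrefl _ this

theorem Joins.weight_eq {k : Fin K} {i j : Fin N} (h : o.Joins k i j) :
    g.a (o.src k) (o.tgt k) = g.a i j := by
  rcases h with ⟨rfl, rfl⟩ | ⟨rfl, rfl⟩
  · rfl
  · exact g.symm _ _

/-- Exactly one edge joins nodes of positive weight; for weight zero every summand vanishes. -/
theorem sum_joins (i j : Fin N) :
    (∑ k, if o.Joins k i j then g.a (o.src k) (o.tgt k) else 0) = g.a i j := by
  rcases (g.nonneg i j).eq_or_lt with h0 | h0
  · rw [← h0]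
    refine Finset.sum_eq_zero fun k _ => ?_
    split_ifs with h
    · rw [h.weight_eq, ← h0]
    · rfl
  · obtain ⟨k, hk, huniq⟩ := o.existsUnique i j h0
    have hk' : o.Joins k i j := hk
    rw [Finset.sum_eq_single k (fun b _ hb => if_neg fun h : o.Joins b i j => hb (huniq b h))
      (fun h => (h (Finset.mem_univ k)).elim), if_pos hk', hk'.weight_eq]

theorem incidence_mul_incidence_of_ne {i j : Fin N} (hij : i ≠ j) (k : Fin K) :
    o.incidence i k * o.incidence j k = if o.Joins k i j then -1 else 0 := by
  have := o.src_ne_tgt k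
  simp only [incidence, of_apply, Joins]
  split_ifs <;> grind

theorem incidence_mul_self (i : Fin N) (k : Fin K) :
    o.incidence i k * o.incidence i k = ∑ j, if o.Joins k i j then 1 else 0 := by
  have hne := o.src_ne_tgt k
  by_cases h1 : i = o.src k
  · have : ∀ j, o.Joins k i j ↔ o.tgt k = j := fun j => by unfold Joins; grind
    simp only [this, incidence, of_apply, if_pos h1]
    simp
  by_cases h2 : i = o.tgt k
  · have : ∀ j, o.Joins k i j ↔ o.src k = j := fun j => by unfold Joins; grind
    simp only [this, incidence, of_apply, if_neg h1, if_pos h2]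
    simp
  · have : ∀ j, ¬ o.Joins k i j := fun j => by unfold Joins; grind
    simp [this, incidence, h1, h2]

/-- `L = R W Rᵀ`. -/
theorem gram_eq_laplacian :
    (o.sqrtWeight * o.incidenceᵀ)ᵀ * (o.sqrtWeight * o.incidenceᵀ) = g.laplacian := by
  ext i j
  have hentry : ((o.sqrtWeight * o.incidenceᵀ)ᵀ * (o.sqrtWeight * o.incidenceᵀ)) i j =
      ∑ k, o.incidence i k * o.incidence j k * g.a (o.src k) (o.tgt k) := by
    rw [mul_apply]
    refine Finset.sum_congr rfl fun k _ => ?_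
    have := Real.mul_self_sqrt (g.nonneg (o.src k) (o.tgt k))
    simp only [sqrtWeight, transpose_apply, diagonal_mul]
    linear_combination o.incidence i k * o.incidence j k * this
  rw [hentry, laplacian, Matrix.sub_apply, diagonal_apply]
  split_ifs with hij
  · subst hij
    simp only [incidence_mul_self, Finset.sum_mul, ite_mul, one_mul, zero_mul]
    rw [Finset.sum_comm, g.loopless, sub_zero]
    exact Finset.sum_congr rfl fun j _ => o.sum_joins i j
  · simp only [incidence_mul_incidence_of_ne o hij, ite_mul, zero_mul]
    rw [← o.sum_joins i j, zero_sub, ← Finset.sum_neg_distrib]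
    refine Finset.sum_congr rfl fun k _ => ?_
    split_ifs <;> simp

theorem posSemidef_laplacian (o : g.EdgeOrientation K) : g.laplacian.PosSemidef := by
  have := posSemidef_conjTranspose_mul_self (o.sqrtWeight * o.incidenceᵀ)
  rwa [conjTranspose_eq_transpose_of_trivial, o.gram_eq_laplacian] at this

/-- The Gram form of L forces W^{1/2}Rᵀv = 0, so v takes equal values across every edge, hence along
every walk. -/
theorem eq_of_laplacian_mulVec_eq_zero (o : g.EdgeOrientation K) (hconn : g.IsConnected) {v : Fin N → ℝ}
    (hv : g.laplacian *ᵥ v = 0) (i j : Fin N) : v i = v j := by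
  have h0 : (o.sqrtWeight * o.incidenceᵀ) *ᵥ v = 0 := by
    rw [← dotProduct_self_eq_zero, ← quadratic_gram, o.gram_eq_laplacian, hv, dotProduct_zero]
  have hedge : ∀ k, v (o.src k) = v (o.tgt k) := fun k => by
    have hk := congrFun h0 k
    rw [← mulVec_mulVec, sqrtWeight, mulVec_diagonal] at hk
    have hinc : (o.incidenceᵀ *ᵥ v) k = v (o.src k) - v (o.tgt k) := by
      have hterm : ∀ l, o.incidence l k * v l =
          (if l = o.src k then v l else 0) - (if l = o.tgt k then v l else 0) := fun l => by
        have := o.src_ne_tgt k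
        simp only [incidence, of_apply]
        split_ifs <;> grind
      simp only [mulVec, dotProduct, transpose_apply, hterm, Finset.sum_sub_distrib]
      simp
    rw [hinc] at hk
    have := (mul_eq_zero.1 hk).resolve_left (Real.sqrt_ne_zero'.2 (o.isEdge k))
    linarith
  have hadj : ∀ i j, g.toSimpleGraph.Adj i j → v i = v j := fun i j h => by
    obtain ⟨k, hk, -⟩ := o.existsUnique i j h
    rcases hk with ⟨rfl, rfl⟩ | ⟨rfl, rfl⟩
    · exact hedge k
    · exact (hedge k).symm
  obtain ⟨w⟩ := hconn.preconnected i j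
  induction w with
  | nil => rfl
  | cons h _ ih => exact (hadj _ _ h).trans ih

end EdgeOrientation

/-! ### Spectral decomposition of the Laplacian -/

variable (g)

theorem laplacian_mulVec_apply (v : Fin N → ℝ) (i : Fin N) :
    (g.laplacian *ᵥ v) i = ∑ j, g.a i j * (v i - v j) := by
  rw [laplacian, sub_mulVec, Pi.sub_apply, mulVec_diagonal]
  simp only [mulVec, dotProduct, mul_sub, Finset.sum_sub_distrib, Finset.sum_mul]

theorem laplacian_mulVec_one : g.laplacian *ᵥ 1 = 0 := by
  ext i
  simp [laplacian_mulVec_apply]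

/-- The Laplacian eigenvalues indexed by the nodes. -/
noncomputable def modeValue (i : Fin N) : ℝ := g.laplacian_isHermitian.eigenvalues i

/-- An orthonormal basis of eigenvectors of the Laplacian. -/
noncomputable def modeVector (i : Fin N) : Fin N → ℝ := g.laplacian_isHermitian.eigenvectorBasis i

theorem laplacian_mulVec_modeVector (i : Fin N) :
    g.laplacian *ᵥ g.modeVector i = g.modeValue i • g.modeVector i :=
  g.laplacian_isHermitian.mulVec_eigenvectorBasis i

theorem modeVector_vecMul_laplacian (i : Fin N) :
    g.modeVector i ᵥ* g.laplacian = g.modeValue i • g.modeVector i := by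
  have h : g.laplacianᵀ = g.laplacian := by
    rw [← conjTranspose_eq_transpose_of_trivial]; exact g.laplacian_isHermitian
  rw [← mulVec_transpose, h, laplacian_mulVec_modeVector]

theorem modeVector_dotProduct (i j : Fin N) :
    g.modeVector i ⬝ᵥ g.modeVector j = if i = j then 1 else 0 := by
  have h := orthonormal_iff_ite.1 g.laplacian_isHermitian.eigenvectorBasis.orthonormal j i
  rw [EuclideanSpace.inner_eq_star_dotProduct] at h
  rw [modeVector, modeVector]
  simpa [eq_comm] using h

theorem sum_modeVector_mul (i j : Fin N) :
    ∑ k, g.modeVector k i * g.modeVector k j = if i = j then 1 else 0 := by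
  have h := congrFun (congrFun (Unitary.coe_mul_star_self g.laplacian_isHermitian.eigenvectorUnitary)
    i) j
  rw [mul_apply, one_apply] at h
  simpa [star_apply, modeVector] using h

theorem laplacian_eq_sum :
    g.laplacian = ∑ k, g.modeValue k • vecMulVec (g.modeVector k) (g.modeVector k) := by
  ext i j
  have h : g.laplacian i j = ∑ k, (g.laplacian *ᵥ g.modeVector k) i * g.modeVector k j := by
    simp only [mulVec, dotProduct, Finset.sum_mul, mul_assoc]
    rw [Finset.sum_comm]
    simp only [← Finset.mul_sum, sum_modeVector_mul]
    simp
  rw [h, Matrix.sum_apply]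
  simp [laplacian_mulVec_modeVector, vecMulVec_apply, mul_assoc]

theorem modeValue_le_lambdaMax (hN : 2 ≤ N) (i : Fin N) : g.modeValue i ≤ g.lambdaMax hN := by
  refine g.laplacian_isHermitian.eigenvalues₀_antitone ?_
  rw [Fin.le_def]
  simp [Fin.val_rev]
  omega

/-- All modes except one have an eigenvalue in `[λ₂, λ_N]`. -/
theorem exists_modes (hN : 2 ≤ N) :
    ∃ i₀ i₁ : Fin N, i₀ ≠ i₁ ∧ (∀ i, g.modeValue i₀ ≤ g.modeValue i) ∧
      g.modeValue i₁ = g.lambdaTwo hN ∧ ∀ i, i ≠ i₀ → g.lambdaTwo hN ≤ g.modeValue i := by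
  set e : Fin (Fintype.card (Fin N)) ≃ Fin N := Fintype.equivOfCardEq (Fintype.card_fin _) with he
  have hc : Fintype.card (Fin N) = N := Fintype.card_fin N
  have hval : ∀ i, g.modeValue i = g.laplacian_isHermitian.eigenvalues₀ (e.symm i) := fun i => rfl
  have hanti := g.laplacian_isHermitian.eigenvalues₀_antitone
  -- The list `eigenvalues₀` is decreasing and indexed from 0, so N - 1 and N - 2 carry the smallest
  -- and second smallest values.
  refine ⟨e ⟨N - 1, by omega⟩, e ⟨N - 2, by omega⟩, ?_, fun i => ?_, ?_, fun i hi => ?_⟩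
  · rw [Ne, e.injective.eq_iff, Fin.mk.injEq]; omega
  · rw [hval, hval, e.symm_apply_apply]
    refine hanti ?_
    rw [Fin.le_def]
    have := (e.symm i).2
    simp only
    omega
  · rw [hval, e.symm_apply_apply]
    refine congrArg _ ?_
    ext
    simp [Fin.val_rev]
  · rw [hval]
    refine hanti ?_
    have h1 : (e.symm i : ℕ) ≠ N - 1 := fun h => hi (by
      rw [← e.symm_apply_eq]; ext; exact h)
    have := (e.symm i).2
    rw [Fin.le_def]
    simp [Fin.val_rev]
    omega

variable {g}

theorem EdgeOrientation.lambdaTwo_pos_and_exists_zero_mode (o : g.EdgeOrientation K)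
    (hconn : g.IsConnected) (hN : 2 ≤ N) :
    0 < g.lambdaTwo hN ∧ ∃ i₀, g.modeValue i₀ = 0 ∧
      ∀ i, i ≠ i₀ → g.lambdaTwo hN ≤ g.modeValue i := by
  obtain ⟨i₀, i₁, hne, hmin, h₁, hge⟩ := g.exists_modes hN
  have hnn : ∀ i, 0 ≤ g.modeValue i := o.posSemidef_laplacian.eigenvalues_nonneg
  -- Otherwise every eigenvector would be orthogonal to the kernel vector 1, which would then
  -- vanish.
  have hzero : g.modeValue i₀ = 0 := by
    by_contra h0
    have hpos : ∀ i, g.modeValue i ≠ 0 := fun i =>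
      (lt_of_lt_of_le (lt_of_le_of_ne (hnn i₀) (Ne.symm h0)) (hmin i)).ne'
    have horth : ∀ i, g.modeVector i ⬝ᵥ (1 : Fin N → ℝ) = 0 := fun i => by
      have h := congrArg (fun v => v ⬝ᵥ (1 : Fin N → ℝ)) (g.modeVector_vecMul_laplacian i)
      simp only [← dotProduct_mulVec, laplacian_mulVec_one, dotProduct_zero, smul_dotProduct,
        smul_eq_mul] at h
      exact (mul_eq_zero.1 h.symm).resolve_left (hpos i)
    have h1 : (1 : ℝ) = ∑ k, g.modeVector k i₀ * (g.modeVector k ⬝ᵥ (1 : Fin N → ℝ)) := by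
      simp only [dotProduct, Pi.one_apply, mul_one, Finset.mul_sum]
      rw [Finset.sum_comm]
      simp [sum_modeVector_mul]
    simp [horth] at h1
  -- If λ₂ = 0, two orthonormal eigenvectors would both be constant.
  refine ⟨lt_of_le_of_ne (h₁ ▸ hnn i₁) fun h => ?_, i₀, hzero, hge⟩
  have hconst : ∀ k, g.modeValue k = 0 → ∀ i, g.modeVector k i = g.modeVector k i₀ := fun k hk i =>
    o.eq_of_laplacian_mulVec_eq_zero hconn
      (by rw [laplacian_mulVec_modeVector, hk, zero_smul]) i i₀
  have hc0 := hconst i₀ hzero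
  have hc1 := hconst i₁ (by rw [h₁, ← h])
  have h00 := g.modeVector_dotProduct i₀ i₀
  have h11 := g.modeVector_dotProduct i₁ i₁
  have h01 := g.modeVector_dotProduct i₀ i₁
  simp only [dotProduct, hc0, hc1, if_neg hne, if_true, Finset.sum_const, nsmul_eq_mul] at h00 h11 h01
  rcases mul_eq_zero.1 h01 with h | h
  · rw [h, zero_mul] at h00
    exact zero_ne_one h00
  · rcases mul_eq_zero.1 h with h | h
    · simp [h] at h00
    · simp [h] at h11

end WeightedGraph

end DistH2

namespace DistH2

/-! ### Projection of network signals onto a mode -/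

section Projection

variable {N : ℕ}

/-- The projection `φᵀ ⊗ I` of network signals to the mode of the vector `φ`. -/
def proj (φ : Fin N → ℝ) (k : ℕ) : Matrix (Fin k) (Fin N × Fin k) ℝ :=
  of fun a ib => φ ib.1 * (1 : Matrix (Fin k) (Fin k) ℝ) a ib.2

theorem proj_mul_kronecker (φ : Fin N → ℝ) {k l : ℕ} (M : Matrix (Fin N) (Fin N) ℝ)
    (X : Matrix (Fin k) (Fin l) ℝ) : proj φ k * (M ⊗ₖ X) = X * proj (φ ᵥ* M) l := by
  ext a ⟨i, b⟩
  simp only [mul_apply, proj, of_apply, Fintype.sum_prod_type, kroneckerMap_apply, one_apply,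
    vecMul, dotProduct, mul_ite, mul_one, mul_zero, ite_mul, zero_mul]
  simp only [Finset.sum_ite_eq, Finset.sum_ite_eq', Finset.mem_univ, if_true, Finset.mul_sum]
  exact Finset.sum_congr rfl fun j _ => by ring

theorem proj_smul (c : ℝ) (φ : Fin N → ℝ) (k : ℕ) : proj (c • φ) k = c • proj φ k := by
  ext a ib
  simp [proj, mul_assoc]

theorem proj_mul_transpose (φ ψ : Fin N → ℝ) (k : ℕ) :
    proj φ k * (proj ψ k)ᵀ = (φ ⬝ᵥ ψ) • (1 : Matrix (Fin k) (Fin k) ℝ) := by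
  ext a b
  simp only [mul_apply, proj, of_apply, transpose_apply, Fintype.sum_prod_type, dotProduct,
    Matrix.smul_apply, smul_eq_mul, Finset.sum_mul]
  refine Finset.sum_congr rfl fun i _ => ?_
  simp [one_apply]

theorem transpose_mul_proj (φ : Fin N → ℝ) (k : ℕ) :
    (proj φ k)ᵀ * proj φ k = vecMulVec φ φ ⊗ₖ (1 : Matrix (Fin k) (Fin k) ℝ) := by
  ext ⟨i, a⟩ ⟨j, b⟩
  simp [mul_apply, proj, vecMulVec_apply, one_apply, eq_comm]

end Projection

/-! ### Modal decomposition of the cost -/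

section Cost

variable {n m q r p N K : ℕ} {S : Agent n m q r p} {g : WeightedGraph N}
  {F : Matrix (Fin m) (Fin n) ℝ} {G : Matrix (Fin n) (Fin r) ℝ} {o : g.EdgeOrientation K}
  {φ : Fin N → ℝ} {l : ℝ}

/-- The projection of network states to a mode. -/
def stateProj (φ : Fin N → ℝ) (n : ℕ) :
    Matrix (Fin n ⊕ Fin n) (Fin N × Fin n ⊕ Fin N × Fin n) ℝ :=
  fromBlocks (proj φ n) 0 0 (proj φ n)

/-- This intertwining carries over to the exponentials by `mul_exp_of_semiconj`. -/
theorem stateProj_mul_Ae (hφ : φ ᵥ* g.laplacian = l • φ) :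
    stateProj φ n * Ae S g F G = modeA S F G l * stateProj φ n := by
  simp only [stateProj, Ae, modeA, fromBlocks_multiply, Matrix.zero_mul, Matrix.mul_zero, add_zero,
    zero_add, Matrix.mul_add, proj_mul_kronecker, vecMul_one, hφ, proj_smul, Matrix.mul_smul,
    Matrix.smul_mul, Matrix.add_mul]

theorem stateProj_mul_Ee (hφ : φ ᵥ* g.laplacian = l • φ) :
    stateProj φ n * Ee S g G = modeE S G l * proj φ q := by
  simp only [stateProj, Ee, modeE, fromBlocks_mul_fromRows, Matrix.zero_mul, add_zero,
    zero_add, proj_mul_kronecker, vecMul_one, hφ, proj_smul, Matrix.mul_smul,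
    Matrix.smul_mul, fromRows_mul]

/-- The impulse response of the network mode of the Laplacian eigenvalue `l`. -/
noncomputable def modeResponse (S : Agent n m q r p) (F : Matrix (Fin m) (Fin n) ℝ)
    (G : Matrix (Fin n) (Fin r) ℝ) (l t : ℝ) : Matrix (Fin p) (Fin q) ℝ :=
  modeC S F * NormedSpace.exp (t • modeA S F G l) * modeE S G l

/-- The output here is z before W^{1/2}Rᵀ acts, since the edge weighting enters the cost only
through its Gram matrix L. -/
theorem proj_mul_response (hφ : φ ᵥ* g.laplacian = l • φ) (t : ℝ) :
    proj φ p * (fromCols ((1 : Matrix (Fin N) (Fin N) ℝ) ⊗ₖ S.C₂)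
        ((1 : Matrix (Fin N) (Fin N) ℝ) ⊗ₖ (S.D₂ * F)) *
        NormedSpace.exp (t • Ae S g F G) * Ee S g G) =
      modeResponse S F G l t * proj φ q := by
  have h1 : proj φ p * fromCols ((1 : Matrix (Fin N) (Fin N) ℝ) ⊗ₖ S.C₂)
      ((1 : Matrix (Fin N) (Fin N) ℝ) ⊗ₖ (S.D₂ * F)) = modeC S F * stateProj φ n := by
    simp only [stateProj, modeC, mul_fromCols, fromCols_mul_fromBlocks, proj_mul_kronecker,
      vecMul_one, Matrix.mul_zero, add_zero, zero_add]
  have h2 : stateProj φ n * NormedSpace.exp (t • Ae S g F G) =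
      NormedSpace.exp (t • modeA S F G l) * stateProj φ n :=
    mul_exp_of_semiconj (by
      rw [Matrix.mul_smul, Matrix.smul_mul, stateProj_mul_Ae hφ])
  rw [← Matrix.mul_assoc, ← Matrix.mul_assoc, h1, Matrix.mul_assoc (modeC S F), h2,
    Matrix.mul_assoc, Matrix.mul_assoc, stateProj_mul_Ee hφ, modeResponse]
  simp only [Matrix.mul_assoc]

/-- The cost density is the weighted sum of the cost densities of the modes. -/
theorem costDensity_eq_sum (t : ℝ) :
    costDensity S F G o t = ∑ k, g.modeValue k *
      ((modeResponse S F G (g.modeValue k) t)ᵀ * modeResponse S F G (g.modeValue k) t).trace := by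
  set M := o.sqrtWeight * o.incidenceᵀ with hM
  set Z := fromCols ((1 : Matrix (Fin N) (Fin N) ℝ) ⊗ₖ S.C₂)
    ((1 : Matrix (Fin N) (Fin N) ℝ) ⊗ₖ (S.D₂ * F)) *
    NormedSpace.exp (t • Ae S g F G) * Ee S g G with hZ
  have hC : impulseResponse S F G o t = (M ⊗ₖ (1 : Matrix (Fin p) (Fin p) ℝ)) * Z := by
    rw [hZ, ← Matrix.mul_assoc, ← Matrix.mul_assoc, mul_fromCols, ← mul_kronecker_mul,
      ← mul_kronecker_mul, Matrix.mul_one, Matrix.one_mul, Matrix.one_mul]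
    rfl
  have hL : (M ⊗ₖ (1 : Matrix (Fin p) (Fin p) ℝ))ᵀ * (M ⊗ₖ (1 : Matrix (Fin p) (Fin p) ℝ)) =
      ∑ k, g.modeValue k • ((proj (g.modeVector k) p)ᵀ * proj (g.modeVector k) p) := by
    rw [← kroneckerMap_transpose, ← mul_kronecker_mul, hM, o.gram_eq_laplacian,
      g.laplacian_eq_sum, transpose_one, Matrix.one_mul]
    simp only [transpose_mul_proj]
    ext ⟨i, a⟩ ⟨j, b⟩
    simp only [kroneckerMap_apply, Matrix.sum_apply, Matrix.smul_apply, smul_eq_mul, Finset.sum_mul,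
      mul_assoc]
  rw [costDensity, hC, transpose_mul, Matrix.mul_assoc, ← Matrix.mul_assoc _ _ Z, hL,
    Matrix.sum_mul, Matrix.mul_sum, trace_sum]
  refine Finset.sum_congr rfl fun k _ => ?_
  have hk := proj_mul_response (S := S) (F := F) (G := G) (g.modeVector_vecMul_laplacian k) t
  rw [← hZ] at hk
  have h1 : Zᵀ * (g.modeValue k • ((proj (g.modeVector k) p)ᵀ * proj (g.modeVector k) p) * Z) =
      g.modeValue k • ((proj (g.modeVector k) p * Z)ᵀ * (proj (g.modeVector k) p * Z)) := by
    rw [Matrix.smul_mul, Matrix.mul_smul, transpose_mul _ Z, Matrix.mul_assoc, Matrix.mul_assoc]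
  -- The eigenvector has unit length, so the remaining projection times its transpose is the
  -- identity.
  rw [h1, hk, trace_smul, smul_eq_mul, transpose_mul, Matrix.mul_assoc, trace_mul_comm,
    Matrix.mul_assoc, Matrix.mul_assoc, proj_mul_transpose, g.modeVector_dotProduct, if_pos rfl,
    one_smul, Matrix.mul_one]

end Cost

/-! ### Synchronization from stability of the nonzero modes -/

section Synchronization

variable {n m q r p N : ℕ} {S : Agent n m q r p} {g : WeightedGraph N}
  {F : Matrix (Fin m) (Fin n) ℝ} {G : Matrix (Fin n) (Fin r) ℝ}

theorem sum_smul_laplacian {φ : Fin N → ℝ} {l : ℝ} (hφ : φ ᵥ* g.laplacian = l • φ) {k : ℕ}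
    (v : Fin N → Fin k → ℝ) :
    ∑ i, φ i • ∑ j, g.a i j • (v i - v j) = l • ∑ i, φ i • v i := by
  ext a
  have h := congrArg (fun ψ => ψ ⬝ᵥ fun i => v i a) hφ
  simp only [← dotProduct_mulVec, smul_dotProduct] at h
  simp only [dotProduct, WeightedGraph.laplacian_mulVec_apply] at h
  simpa [Finset.sum_apply] using h

theorem mulVec_sum_smul {k k' : ℕ} (M : Matrix (Fin k') (Fin k) ℝ) (φ : Fin N → ℝ)
    (v : Fin N → Fin k → ℝ) : ∑ i, φ i • M *ᵥ v i = M *ᵥ ∑ i, φ i • v i := by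
  rw [mulVec_sum]
  simp only [mulVec_smul]

/-- The modes of an undisturbed trajectory of the network evolve independently. -/
theorem hasDerivWithinAt_mode {φ : Fin N → ℝ} {l : ℝ} (hφ : φ ᵥ* g.laplacian = l • φ)
    {x w : Fin N → ℝ → Fin n → ℝ} {u : Fin N → ℝ → Fin m → ℝ} {y : Fin N → ℝ → Fin r → ℝ}
    (h : IsTrajectory S g F G (fun _ _ => 0) x w u y) (t : ℝ) (ht : t ∈ Ici (0 : ℝ)) :
    HasDerivWithinAt (fun t => Sum.elim (∑ i, φ i • x i t) (∑ i, φ i • w i t))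
      (modeA S F G l *ᵥ Sum.elim (∑ i, φ i • x i t) (∑ i, φ i • w i t)) (Ici 0) t := by
  have hx := HasDerivWithinAt.fun_sum (u := Finset.univ) fun i _ => (h.state i t ht).fun_const_smul (φ i)
  have hw := HasDerivWithinAt.fun_sum (u := Finset.univ) fun i _ =>
    (h.observer i t ht).fun_const_smul (φ i)
  have hu : ∀ i, u i t = F *ᵥ w i t := fun i => h.input i t
  have hy : ∀ i, y i t = S.C₁ *ᵥ x i t := fun i => by rw [h.output, mulVec_zero, add_zero]
  have hx' : ∑ i, φ i • (S.A *ᵥ x i t + S.B *ᵥ u i t + S.E *ᵥ (0 : Fin q → ℝ)) =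
      S.A *ᵥ (∑ i, φ i • x i t) + (S.B * F) *ᵥ ∑ i, φ i • w i t := by
    simp only [hu, mulVec_zero, add_zero, smul_add, Finset.sum_add_distrib, mulVec_mulVec,
      mulVec_sum_smul]
  have hw' : ∑ i, φ i • (S.A *ᵥ w i t + S.B *ᵥ (∑ j, g.a i j • (u i t - u j t))
        + G *ᵥ ((∑ j, g.a i j • (y i t - y j t)) - S.C₁ *ᵥ w i t)) =
      (l • (G * S.C₁)) *ᵥ (∑ i, φ i • x i t) +
        (S.A - G * S.C₁ + l • (S.B * F)) *ᵥ ∑ i, φ i • w i t := by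
    have hsplit : ∀ i, φ i • (S.A *ᵥ w i t + S.B *ᵥ (∑ j, g.a i j • (u i t - u j t))
        + G *ᵥ ((∑ j, g.a i j • (y i t - y j t)) - S.C₁ *ᵥ w i t)) =
        φ i • S.A *ᵥ w i t + φ i • S.B *ᵥ (∑ j, g.a i j • (u i t - u j t)) +
          (φ i • G *ᵥ (∑ j, g.a i j • (y i t - y j t)) - φ i • G *ᵥ S.C₁ *ᵥ w i t) := fun i => by
      rw [smul_add, smul_add, mulVec_sub, smul_sub]
    simp only [hsplit, Finset.sum_add_distrib, Finset.sum_sub_distrib, mulVec_sum_smul,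
      sum_smul_laplacian hφ (fun i => u i t), sum_smul_laplacian hφ (fun i => y i t)]
    simp only [hu, hy, mulVec_sum_smul, mulVec_smul, add_mulVec, sub_mulVec, smul_mulVec,
      mulVec_mulVec]
    abel
  rw [hx'] at hx
  rw [hw'] at hw
  rw [modeA, fromBlocks_mulVec, Sum.elim_comp_inl, Sum.elim_comp_inr]
  refine hasDerivWithinAt_pi.2 fun a => ?_
  rcases a with a | a
  · exact hasDerivWithinAt_pi.1 hx a
  · exact hasDerivWithinAt_pi.1 hw a

/-- Eigenbasis expansion; a constant eigenvector has coefficient zero, which removes the possibly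
unstable mode. -/
theorem sub_eq_sum_modes (v : Fin N → Fin n → ℝ) (i j : Fin N) :
    v i - v j = ∑ k, (g.modeVector k i - g.modeVector k j) • ∑ s, g.modeVector k s • v s := by
  have h : ∀ i, v i = ∑ k, g.modeVector k i • ∑ s, g.modeVector k s • v s := fun i => by
    simp only [Finset.smul_sum, smul_smul]
    rw [Finset.sum_comm]
    simp only [← Finset.sum_smul, g.sum_modeVector_mul]
    simp
  simp only [sub_smul, Finset.sum_sub_distrib]
  rw [← h i, ← h j]

/-- If all modes with nonzero Laplacian eigenvalue are stable, the network synchronizes. -/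
theorem synchronizes_of_modes {K : ℕ} (o : g.EdgeOrientation K) (hconn : g.IsConnected)
    (hstable : ∀ k, g.modeValue k ≠ 0 → ∀ x : ℝ → Fin n ⊕ Fin n → ℝ,
      (∀ t ∈ Ici (0 : ℝ), HasDerivWithinAt x (modeA S F G (g.modeValue k) *ᵥ x t) (Ici 0) t) →
      Tendsto x atTop (𝓝 0)) :
    Synchronizes S g F G := by
  intro x w u y h i j
  have hmode : ∀ k, g.modeVector k i - g.modeVector k j = 0 ∨
      Tendsto (fun t => Sum.elim (∑ s, g.modeVector k s • x s t)
        (∑ s, g.modeVector k s • w s t)) atTop (𝓝 0) := fun k => by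
    by_cases hk : g.modeValue k = 0
    · left
      rw [o.eq_of_laplacian_mulVec_eq_zero hconn (v := g.modeVector k)
        (by rw [g.laplacian_mulVec_modeVector, hk, zero_smul]) i j, sub_self]
    · right
      exact hstable k hk _ (hasDerivWithinAt_mode (g.modeVector_vecMul_laplacian k) h)
  have hsum : ∀ v : Fin N → ℝ → Fin n → ℝ,
      (∀ k, g.modeVector k i - g.modeVector k j = 0 ∨
        Tendsto (fun t => ∑ s, g.modeVector k s • v s t) atTop (𝓝 0)) →
      Tendsto (fun t => v i t - v j t) atTop (𝓝 0) := fun v hv => by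
    have hlim : Tendsto (fun t => ∑ k, (g.modeVector k i - g.modeVector k j) •
        ∑ s, g.modeVector k s • v s t) atTop (𝓝 (∑ _k : Fin N, (0 : Fin n → ℝ))) := by
      refine tendsto_finsetSum _ fun k _ => ?_
      rcases hv k with h0 | h0
      · simp only [h0, zero_smul]
        exact tendsto_const_nhds
      · simpa using h0.const_smul (g.modeVector k i - g.modeVector k j)
    rw [Finset.sum_const_zero] at hlim
    exact hlim.congr fun t => (sub_eq_sum_modes (fun s => v s t) i j).symm
  constructor
  · refine hsum x fun k => (hmode k).imp_right fun hk => tendsto_pi_nhds.2 fun a => ?_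
    exact (tendsto_pi_nhds.1 hk) (Sum.inl a)
  · refine hsum w fun k => (hmode k).imp_right fun hk => tendsto_pi_nhds.2 fun a => ?_
    exact (tendsto_pi_nhds.1 hk) (Sum.inr a)

end Synchronization

/-! ### Assembly of the modes and choice of the Riccati coefficient -/

section Main

variable {n m q r p N K : ℕ} {S : Agent n m q r p} {g : WeightedGraph N}

/-- The designed gains solve the problem when the Riccati coefficient `κ` dominates
`c² λ³ - 2 c λ` for every nonzero Laplacian eigenvalue `λ`. -/
theorem solvesProblem_of_riccati (hN : 2 ≤ N) (hconn : g.IsConnected) (o : g.EdgeOrientation K)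
    {γ : ℝ} (hDE : S.D₁ * S.Eᵀ = 0) (hDC : S.D₂ᵀ * S.C₂ = 0)
    (hD₁ : S.D₁ * S.D₁ᵀ = 1) (hD₂ : S.D₂ᵀ * S.D₂ = 1)
    {Q : Matrix (Fin n) (Fin n) ℝ} (hQ : Q.PosDef)
    (hQric : NegDef (S.A * Q + Q * S.Aᵀ - Q * S.C₁ᵀ * S.C₁ * Q + S.E * S.Eᵀ))
    {c κ : ℝ} (hκ : ∀ l, g.lambdaTwo hN ≤ l → l ≤ g.lambdaMax hN →
      c ^ 2 * l ^ 3 - 2 * c * l ≤ κ)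
    {P : Matrix (Fin n) (Fin n) ℝ} (hP : P.PosDef)
    (hPric : NegDef (S.Aᵀ * P + P * S.A + κ • (P * S.B * S.Bᵀ * P)
      + g.lambdaMax hN • (S.C₂ᵀ * S.C₂)))
    (hγ : (S.C₁ * Q * P * Q * S.C₁ᵀ).trace + g.lambdaMax hN * (S.C₂ * Q * S.C₂ᵀ).trace
      < γ / ((N : ℝ) - 1)) :
    SolvesProblem S (-(c • (S.Bᵀ * P))) (Q * S.C₁ᵀ) o γ := by
  obtain ⟨hpos, i₀, hi₀, hge⟩ := o.lambdaTwo_pos_and_exists_zero_mode hconn hN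
  set F : Matrix (Fin m) (Fin n) ℝ := -(c • (S.Bᵀ * P)) with hF
  set G : Matrix (Fin n) (Fin r) ℝ := Q * S.C₁ᵀ with hG
  have hcov := fun k (hk : k ≠ i₀) => exists_modeCov hDE hDC hD₁ hD₂ hQ hQric
    (hpos.trans_le (hge k hk)) (g.modeValue_le_lambdaMax hN k)
    (hκ _ (hge k hk) (g.modeValue_le_lambdaMax hN k)) hP hPric hγ
  have hint : ∀ k, k ≠ i₀ → IntegrableOn (fun t => g.modeValue k *
        ((modeResponse S F G (g.modeValue k) t)ᵀ *
          modeResponse S F G (g.modeValue k) t).trace) (Ioi 0) ∧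
      ∫ t in Ioi (0 : ℝ), g.modeValue k * ((modeResponse S F G (g.modeValue k) t)ᵀ *
          modeResponse S F G (g.modeValue k) t).trace < γ / ((N : ℝ) - 1) := fun k hk => by
    obtain ⟨Y, hY, hL, htr⟩ := hcov k hk
    obtain ⟨h1, h2⟩ := integral_trace_le_of_lyapunov (modeC S F) hY.posSemidef hL.posSemidef
    refine ⟨h1.const_mul _, ?_⟩
    rw [integral_const_mul]
    exact (mul_le_mul_of_nonneg_left h2 (hpos.trans_le (hge k hk)).le).trans_lt htr
  have hzero : ∀ t, g.modeValue i₀ * ((modeResponse S F G (g.modeValue i₀) t)ᵀ *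
      modeResponse S F G (g.modeValue i₀) t).trace = 0 := fun t => by rw [hi₀, zero_mul]
  have hdens : costDensity S F G o = fun t => ∑ k ∈ Finset.univ.erase i₀, g.modeValue k *
      ((modeResponse S F G (g.modeValue k) t)ᵀ * modeResponse S F G (g.modeValue k) t).trace := by
    funext t
    rw [costDensity_eq_sum, ← Finset.add_sum_erase _ _ (Finset.mem_univ i₀), hzero, zero_add]
  have hcard : (Finset.univ.erase i₀).card = N - 1 := by
    rw [Finset.card_erase_of_mem (Finset.mem_univ _), Finset.card_univ, Fintype.card_fin]
  refine ⟨synchronizes_of_modes o hconn fun k hk x hx => ?_, ?_, ?_⟩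
  · obtain ⟨Y, hY, hL, -⟩ := hcov k (fun h => hk (h ▸ hi₀))
    exact tendsto_zero_of_modeCov hY hL hx
  · rw [hdens]
    exact integrable_finsetSum _ fun k hk => (hint k (Finset.ne_of_mem_erase hk)).1
  · rw [cost, hdens, integral_finsetSum _ fun k hk => (hint k (Finset.ne_of_mem_erase hk)).1]
    -- N ≥ 2 leaves at least one mode, as strictness of the summed bound requires.
    have hne : (Finset.univ.erase i₀).Nonempty := by
      rw [← Finset.card_pos, hcard]; omega
    refine (Finset.sum_lt_sum_of_nonempty hne
      fun k hk => (hint k (Finset.ne_of_mem_erase hk)).2).trans_le ?_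
    have hN' : (0 : ℝ) < (N : ℝ) - 1 := by
      have : (2 : ℝ) ≤ N := by exact_mod_cast hN
      linarith
    rw [Finset.sum_const, hcard, nsmul_eq_mul, Nat.cast_sub (by omega), Nat.cast_one,
      mul_div_cancel₀ _ hN'.ne']

/-- The maximum of the convex function `c² λ³ - 2 c λ` on `[a, b]` is attained at `b`. -/
theorem cubic_le_right {a b c l : ℝ} (ha : 0 < a) (hal : a ≤ l) (hlb : l ≤ b)
    (hc : 2 / (a ^ 2 + a * b + b ^ 2) ≤ c) :
    c ^ 2 * l ^ 3 - 2 * c * l ≤ c ^ 2 * b ^ 3 - 2 * c * b := by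
  have hb : 0 < b := by linarith
  have hc0 : 0 < c := lt_of_lt_of_le (by positivity) hc
  rw [div_le_iff₀ (by positivity)] at hc
  have h1 : a ^ 2 + a * b + b ^ 2 ≤ l ^ 2 + l * b + b ^ 2 := by nlinarith
  have h2 : 0 ≤ c * (l ^ 2 + l * b + b ^ 2) - 2 := by nlinarith
  -- This product is the difference of the cubic's values at b and l.
  have h3 : 0 ≤ c * (b - l) * (c * (l ^ 2 + l * b + b ^ 2) - 2) :=
    mul_nonneg (mul_nonneg hc0.le (sub_nonneg.2 hlb)) h2
  linarith [h3]

/-- The maximum of the convex function `c² λ³ - 2 c λ` on `[a, b]` is attained at `a`. -/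
theorem cubic_le_left {a b c l : ℝ} (ha : 0 < a) (hal : a ≤ l) (hlb : l ≤ b) (hc0 : 0 < c)
    (hc : c < 2 / (a ^ 2 + a * b + b ^ 2)) :
    c ^ 2 * l ^ 3 - 2 * c * l ≤ c ^ 2 * a ^ 3 - 2 * c * a := by
  have hb : 0 < b := by linarith
  rw [lt_div_iff₀ (by positivity)] at hc
  have h1 : a ^ 2 + a * l + l ^ 2 ≤ a ^ 2 + a * b + b ^ 2 := by nlinarith
  have h2 : c * (a ^ 2 + a * l + l ^ 2) - 2 ≤ 0 := by nlinarith
  have h3 : c * (l - a) * (c * (a ^ 2 + a * l + l ^ 2) - 2) ≤ 0 :=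
    mul_nonpos_of_nonneg_of_nonpos (mul_nonneg hc0.le (sub_nonneg.2 hal)) h2
  linarith [h3]

theorem cubic_neg {c b : ℝ} (hb : 0 < b) (hc : 0 < c) (h : c < 2 / b ^ 2) :
    c ^ 2 * b ^ 3 - 2 * c * b < 0 := by
  rw [lt_div_iff₀ (by positivity)] at h
  have : c * b * (c * b ^ 2 - 2) < 0 :=
    mul_neg_of_pos_of_neg (by positivity) (by linarith)
  linarith [this]

end Main

end DistH2

theorem mainTheorem1 {n m q r p N K : ℕ} (hN : 2 ≤ N)
    (S : DistH2.Agent n m q r p)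
    (hstab : DistH2.Stabilizable S.A S.B) (hdet : DistH2.Detectable S.C₁ S.A)
    (g : DistH2.WeightedGraph N) (hconn : g.IsConnected) (o : g.EdgeOrientation K)
    (γ : ℝ) (hγ : 0 < γ)
    (hDE : S.D₁ * S.Eᵀ = 0) (hDC : S.D₂ᵀ * S.C₂ = 0)
    (hD₁ : S.D₁ * S.D₁ᵀ = 1) (hD₂ : S.D₂ᵀ * S.D₂ = 1)
    (Q : Matrix (Fin n) (Fin n) ℝ) (hQ : Q.PosDef)
    (hQric : DistH2.NegDef
      (S.A * Q + Q * S.Aᵀ - Q * S.C₁ᵀ * S.C₁ * Q + S.E * S.Eᵀ))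
    (c : ℝ) (hc : 0 < c) (hc' : c < 2 / g.lambdaMax hN ^ 2) :
    (2 / (g.lambdaTwo hN ^ 2 + g.lambdaTwo hN * g.lambdaMax hN + g.lambdaMax hN ^ 2) ≤ c →
      (∃ P : Matrix (Fin n) (Fin n) ℝ, P.PosDef ∧ DistH2.NegDef
        (S.Aᵀ * P + P * S.A
          + (c ^ 2 * g.lambdaMax hN ^ 3 - 2 * c * g.lambdaMax hN) • (P * S.B * S.Bᵀ * P)
          + g.lambdaMax hN • (S.C₂ᵀ * S.C₂))) ∧
      ∀ P : Matrix (Fin n) (Fin n) ℝ, P.PosDef → DistH2.NegDef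
        (S.Aᵀ * P + P * S.A
          + (c ^ 2 * g.lambdaMax hN ^ 3 - 2 * c * g.lambdaMax hN) • (P * S.B * S.Bᵀ * P)
          + g.lambdaMax hN • (S.C₂ᵀ * S.C₂)) →
        (S.C₁ * Q * P * Q * S.C₁ᵀ).trace + g.lambdaMax hN * (S.C₂ * Q * S.C₂ᵀ).trace
          < γ / ((N : ℝ) - 1) →
        DistH2.SolvesProblem S (-(c • (S.Bᵀ * P))) (Q * S.C₁ᵀ) o γ) ∧
    (c < 2 / (g.lambdaTwo hN ^ 2 + g.lambdaTwo hN * g.lambdaMax hN + g.lambdaMax hN ^ 2) →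
      (∃ P : Matrix (Fin n) (Fin n) ℝ, P.PosDef ∧ DistH2.NegDef
        (S.Aᵀ * P + P * S.A
          + (c ^ 2 * g.lambdaTwo hN ^ 3 - 2 * c * g.lambdaTwo hN) • (P * S.B * S.Bᵀ * P)
          + g.lambdaMax hN • (S.C₂ᵀ * S.C₂))) ∧
      ∀ P : Matrix (Fin n) (Fin n) ℝ, P.PosDef → DistH2.NegDef
        (S.Aᵀ * P + P * S.A
          + (c ^ 2 * g.lambdaTwo hN ^ 3 - 2 * c * g.lambdaTwo hN) • (P * S.B * S.Bᵀ * P)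
          + g.lambdaMax hN • (S.C₂ᵀ * S.C₂)) →
        (S.C₁ * Q * P * Q * S.C₁ᵀ).trace + g.lambdaMax hN * (S.C₂ * Q * S.C₂ᵀ).trace
          < γ / ((N : ℝ) - 1) →
        DistH2.SolvesProblem S (-(c • (S.Bᵀ * P))) (Q * S.C₁ᵀ) o γ) := by
  obtain ⟨hpos, i₀, hi₀, hge⟩ := o.lambdaTwo_pos_and_exists_zero_mode hconn hN
  have hle : g.lambdaTwo hN ≤ g.lambdaMax hN := by
    have : Nontrivial (Fin N) := Fin.nontrivial_iff_two_le.2 hN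
    obtain ⟨k, hk⟩ := exists_ne i₀
    exact (hge k hk).trans (g.modeValue_le_lambdaMax hN k)
  have hpos' := hpos.trans_le hle
  have hR : (g.lambdaMax hN • (S.C₂ᵀ * S.C₂))ᵀ = g.lambdaMax hN • (S.C₂ᵀ * S.C₂) := by
    rw [transpose_smul, transpose_mul, transpose_transpose]
  refine ⟨fun hi => ⟨hstab.exists_riccati (DistH2.cubic_neg hpos' hc hc') hR,
      fun P hP hPric hPγ => ?_⟩,
    fun hii => ⟨hstab.exists_riccati (DistH2.cubic_neg hpos hc (hc'.trans_le ?_)) hR,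
      fun P hP hPric hPγ => ?_⟩⟩
  · exact DistH2.solvesProblem_of_riccati hN hconn o hDE hDC hD₁ hD₂ hQ hQric
      (fun l h1 h2 => DistH2.cubic_le_right hpos h1 h2 hi) hP hPric hPγ
  -- As λ₂ ≤ λ_N, the bound c < 2/λ_N² implies c < 2/λ₂², so the coefficient at λ₂ is negative too.
  · exact div_le_div_of_nonneg_left zero_le_two (by positivity) (by gcongr)
  · exact DistH2.solvesProblem_of_riccati hN hconn o hDE hDC hD₁ hD₂ hQ hQric
      (fun l h1 h2 => DistH2.cubic_le_left hpos h1 h2 hc hii) hP hPric hPγ
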